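/- Let $n\ge 1$ be an integer, $0<s<1$ and $1\le p<+\infty$. Write $\mathbb R^{n+1}_+=\mathbb R^n\times(0,+\infty)$ and $\overline{\mathbb R}{}^{n+1}_+=\mathbb R^n\times[0,+\infty)$. For a finite-dimensional Euclidean space $F$, let $\mathfrak o(F)$ be the space of skew-adjoint endomorphisms of $F$. For $\Gamma\in C^1(\overline{\mathbb R}{}^{n+1}_+,\mathrm{Lin}(\mathbb R^{n+1},\mathfrak o(F)))$ and $U\in C^1_c(\overline{\mathbb R}{}^{n+1}_+,F)$ (the support is compact but may meet the boundary), set $$D_\Gamma U(z)[v]=DU(z)[v]+\Gamma(z)[v]\,U(z),$$ $$\mathscr K_\Gamma(z)[v,w]=D\Gamma(z)[v,w]-D\Gamma(z)[w,v]+\Gamma(z)[v]\Gamma(z)[w]-\Gamma(z)[w]\Gamma(z)[v],$$ where $D\Gamma(z)[v,w]$ is the derivative at $z$ of $\Gamma(\cdot)[w]$ in the direction $v$, and $$\|\mathscr K_\Gamma\|_\infty=\sup_{z\in\overline{\mathbb R}{}^{n+1}_+}\ \sup_{v,w\in\mathbb R^{n+1}\setminus\{0\}}\frac{|\mathscr K_\Gamma(z)[v,w]|}{|v|\,|w|}\in[0,+\infty],$$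 with the operator norm on endomorphisms of $F$; $|D_\Gamma U(z)|$ denotes the Hilbert–Schmidt norm. Let $\Gamma_\shortparallel(x)[v]=\Gamma(x,0)[(v,0)]$ for $x,v\in\mathbb R^n$, and for $x,y\in\mathbb R^n$ let $R^{\Gamma_\shortparallel}(x,y)=P(0)$, where $P\colon[0,1]\to\mathrm{Lin}(F,F)$ is the solution of $$P'(t)+\Gamma_\shortparallel((1-t)x+ty)[y-x]\,P(t)=0\quad(t\in[0,1]),\qquad P(1)=\mathrm{id}_F$$ (the parallel transport from $y$ to $x$ along the segment). For $u\colon\mathbb R^n\to F$ put $$|u|_{W^{s,p}_{\Gamma_\shortparallel}(\mathbb R^n,F)}=\Bigl(\int_{\mathbb R^n}\int_{\mathbb R^n}\frac{|u(x)-R^{\Gamma_\shortparallel}(x,y)u(y)|^p}{|x-y|^{n+sp}}\,dy\,dx\Bigr)^{1/p}.$$ **Proposition.** There exists a constant $C=C(n,s,p)>0$, depending only on $n$, $s$ and $p$, such that for every finite-dimensional Euclidean space $F$, every $\Gamma\in C^1(\overline{\mathbb R}{}^{n+1}_+,\mathrm{Lin}(\mathbb R^{n+1},\mathfrak o(F)))$,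 every real $\beta\ge\|\mathscr K_\Gamma\|_\infty$ and every $U\in C^1_c(\overline{\mathbb R}{}^{n+1}_+,F)$, $$|U(\cdot,0)|^p_{W^{s,p}_{\Gamma_\shortparallel}(\mathbb R^n,F)}\le C\int_{\mathbb R^{n+1}_+}\frac{|D_\Gamma U(z)|^p+\beta^{p/2}|U(z)|^p}{z_{n+1}^{1-(1-s)p}}\,dz$$ and $$\|U(\cdot,0)\|^p_{L^p(\mathbb R^n,F)}\le C\Bigl(\int_{\mathbb R^{n+1}_+}\frac{|D_\Gamma U(z)|^p}{z_{n+1}^{1-(1-s)p}}\,dz\Bigr)^{1-s}\Bigl(\int_{\mathbb R^{n+1}_+}\frac{|U(z)|^p}{z_{n+1}^{1-(1-s)p}}\,dz\Bigr)^{s}.$$ -/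

import Mathlib

open MeasureTheory Set
open scoped ENNReal NNReal

noncomputable section

namespace GaugeTrace

/-- The closed half-space `ℝⁿ × [0, ∞)` in `ℝⁿ⁺¹`; the last coordinate is the normal one. -/
def closedHalfSpace (n : ℕ) : Set (EuclideanSpace ℝ (Fin (n + 1))) :=
  {z | 0 ≤ z (Fin.last n)}

/-- The open half-space `ℝⁿ × (0, ∞)` in `ℝⁿ⁺¹`. -/
def openHalfSpace (n : ℕ) : Set (EuclideanSpace ℝ (Fin (n + 1))) :=
  {z | 0 < z (Fin.last n)}

/-- The linear embedding `x ↦ (x, 0)` of `ℝⁿ` as the boundary of the half-space. -/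
def boundaryEmb (n : ℕ) : EuclideanSpace ℝ (Fin n) →L[ℝ] EuclideanSpace ℝ (Fin (n + 1)) :=
  LinearMap.toContinuousLinearMap
    { toFun := fun x => WithLp.toLp 2 (Fin.snoc (α := fun _ => ℝ) (fun i => x i) 0)
      map_add' := fun x y => by
        ext i
        refine Fin.lastCases ?_ (fun j => ?_) i <;> simp
      map_smul' := fun c x => by
        ext i
        refine Fin.lastCases ?_ (fun j => ?_) i <;> simp }

variable {F : Type*} [NormedAddCommGroup F] [InnerProductSpace ℝ F]

section General

variable {V : Type*} [NormedAddCommGroup V] [NormedSpace ℝ V]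

/-- `Γ` is a connection form of class `C¹` on `Ω`, with values in `Lin(V, 𝔬(F))`, where `𝔬(F)` is
the space of skew-adjoint endomorphisms of `F`. -/
def IsC1ConnectionForm (Ω : Set V) (Γ : V → V →L[ℝ] (F →L[ℝ] F)) : Prop :=
  ContDiffOn ℝ 1 Γ Ω ∧
    ∀ z ∈ Ω, ∀ v : V, ∀ a b : F, inner ℝ (Γ z v a) b = -inner ℝ a (Γ z v b)

/-- `U` is of class `C¹` on `Ω` and vanishes on `Ω` outside of a compact subset of `Ω`. -/
def IsC1CompactlySupportedOn (Ω : Set V) (U : V → F) : Prop :=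
  ContDiffOn ℝ 1 U Ω ∧ ∃ K : Set V, IsCompact K ∧ K ⊆ Ω ∧ ∀ z ∈ Ω, z ∉ K → U z = 0

/-- The covariant derivative `D_Γ U(z)[v] = DU(z)[v] + Γ(z)[v] U(z)` on `Ω`. -/
def covDeriv (Ω : Set V) (Γ : V → V →L[ℝ] (F →L[ℝ] F)) (U : V → F) (z : V) : V →L[ℝ] F :=
  fderivWithin ℝ U Ω z + (Γ z).flip (U z)

/-- The curvature
`K_Γ(z)[v, w] = DΓ(z)[v, w] - DΓ(z)[w, v] + Γ(z)[v] Γ(z)[w] - Γ(z)[w] Γ(z)[v]`, where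
`DΓ(z)[v, w]` is the derivative of `Γ(·)[w]` in the direction `v`. -/
def curvature (Ω : Set V) (Γ : V → V →L[ℝ] (F →L[ℝ] F)) (z v w : V) : F →L[ℝ] F :=
  fderivWithin ℝ Γ Ω z v w - fderivWithin ℝ Γ Ω z w v
    + (Γ z v).comp (Γ z w) - (Γ z w).comp (Γ z v)

/-- The supremum over `z ∈ Ω` and `v, w` of `|K_Γ(z)[v, w]| / (|v| |w|)`, for the operator norm on
the endomorphisms of `F`; it may be infinite. (Terms with `v = 0` or `w = 0` are `0 / 0 = 0`.) -/
def curvatureNorm (Ω : Set V) (Γ : V → V →L[ℝ] (F →L[ℝ] F)) : ℝ≥0∞ :=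
  ⨆ z ∈ Ω, ⨆ v : V, ⨆ w : V, ‖curvature Ω Γ z v w‖ₑ / (‖v‖ₑ * ‖w‖ₑ)

/-- `P` solves the final value problem `P'(t) + Γ(γ(t))[γ'(t)] P(t) = 0` for `t ∈ [0, 1]`,
`P(1) = id`. -/
def IsParallelTransport (Γ : V → V →L[ℝ] (F →L[ℝ] F)) (γ : ℝ → V) (P : ℝ → F →L[ℝ] F) : Prop :=
  (∀ t ∈ Icc (0 : ℝ) 1, HasDerivWithinAt P
      (-((Γ (γ t) (derivWithin γ (Icc 0 1) t)).comp (P t))) (Icc 0 1) t) ∧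
    P 1 = ContinuousLinearMap.id ℝ F

open Classical in
/-- The parallel transport operator along `γ`: the solution of the final value problem above (it
exists and is unique on `[0, 1]` when `γ` is `C¹` and `Γ` is continuous along `γ`). -/
def parallelTransport (Γ : V → V →L[ℝ] (F →L[ℝ] F)) (γ : ℝ → V) : ℝ → F →L[ℝ] F :=
  if h : ∃ P, IsParallelTransport Γ γ P then h.choose else fun _ => ContinuousLinearMap.id ℝ F

/-- `R^Γ(x, y)`, the parallel transport from `y` to `x` along `t ↦ (1 - t) x + t y`. -/
def segmentTransport (Γ : V → V →L[ℝ] (F →L[ℝ] F)) (x y : V) : F →L[ℝ] F :=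
  parallelTransport Γ (fun t => (1 - t) • x + t • y) 0

end General

/-- The Hilbert-Schmidt norm on `Lin(ℝᵐ, F)`. -/
def hsNorm {m : ℕ} (T : EuclideanSpace ℝ (Fin m) →L[ℝ] F) : ℝ :=
  Real.sqrt (∑ i, ‖T (EuclideanSpace.single i 1)‖ ^ 2)

/-- The tangential connection form `Γ_∥(x)[v] = Γ(x, 0)[v, 0]` on `ℝⁿ`. -/
def tangential {n : ℕ}
    (Γ : EuclideanSpace ℝ (Fin (n + 1)) → EuclideanSpace ℝ (Fin (n + 1)) →L[ℝ] (F →L[ℝ] F))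
    (x : EuclideanSpace ℝ (Fin n)) : EuclideanSpace ℝ (Fin n) →L[ℝ] (F →L[ℝ] F) :=
  (Γ (boundaryEmb n x)).comp (boundaryEmb n)

/-- The gauge-covariant Gagliardo seminorm of `u` for the connection form `A` on `ℝⁿ`; it may be
infinite. -/
def gagliardoSeminorm {n : ℕ} (s p : ℝ)
    (A : EuclideanSpace ℝ (Fin n) → EuclideanSpace ℝ (Fin n) →L[ℝ] (F →L[ℝ] F))
    (u : EuclideanSpace ℝ (Fin n) → F) : ℝ≥0∞ :=
  (∫⁻ x, ∫⁻ y, ENNReal.ofReal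
    (‖u x - segmentTransport A x y (u y)‖ ^ p / ‖x - y‖ ^ ((n : ℝ) + s * p))) ^ (1 / p)

/-- The weighted integral `∫ f(z) / z_{n+1}^{1 - (1 - s) p} dz` over the open half-space, for
`f ≥ 0`. -/
def weightedIntegral (n : ℕ) (s p : ℝ) (f : EuclideanSpace ℝ (Fin (n + 1)) → ℝ) : ℝ≥0∞ :=
  ∫⁻ z in openHalfSpace n, ENNReal.ofReal (f z / z (Fin.last n) ^ (1 - (1 - s) * p))

end GaugeTrace

end

open GaugeTrace

/-! The connection enters only through two bounds whose right-hand sides are scalar. Since `Γ` is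
skew, |U| changes along a segment by at most the integral of |D_Γ U|
(`abs_norm_sub_norm_le_integral_covDeriv`, the diamagnetic inequality). And on the rectangle of
height |h| over the boundary segment from x to x + h, the difference u(x) - R u(x + h) is bounded by
the integrals of |D_Γ U| over the top and the two vertical sides, plus β|h| times the integral of
|U| over one vertical side (`norm_sub_transport_le`).

For the second bound, lift the segment to height t and follow E(t) = U(x, t) - P_t U(x + h, t),
where P_t is the transport along the lifted segment. An infinitesimal form of the non-abelian Stokes
theorem (`eventually_norm_transport_sub_le`) says that P_t varies covariantly at a rate at most
β|h|, so |E| grows at the stated rate; at the top, E is bounded by integrating D_Γ U.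

The rest concerns f = |D_Γ U| and g = |U| (`gagliardo_le`). If β|h|² ≤ 1, then β|h| ≤ √β and the
curvature term is absorbed by replacing f with f + √β g; the vertical sides are handled by Hardy's
inequality, the top by Jensen's inequality and translation invariance, with |h| becoming the height.
If |h| > β^(-1/2), transport being isometric, the difference is at most |u(x)| + |u(x + h)|; the
tail of the kernel and the trace estimate `trace_le` at scale T = β^(-1/2) then produce exactly the
weight β^(p/2).

The multiplicative L^p bound is `trace_le` optimised over T (`le_of_forall_scale`); compact support
makes the energies finite. -/

namespace GaugeTrace

set_option linter.unusedSectionVars false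

open Filter Topology

/-! ### Linear differential equations on [0, 1] -/

section LinearODE

variable {E : Type*} [NormedAddCommGroup E] [NormedSpace ℝ E]

/-- The radial retraction onto the closed ball of radius `r`. -/
noncomputable def radialRetraction (r : ℝ) (x : E) : E := (r / max r ‖x‖) • x

theorem radialRetraction_eq_self {r : ℝ} (hr : 0 < r) {x : E} (hx : ‖x‖ ≤ r) :
    radialRetraction r x = x := by
  simp [radialRetraction, max_eq_left hx, hr.ne']

theorem norm_radialRetraction_le_norm {r : ℝ} (hr : 0 < r) (x : E) :
    ‖radialRetraction r x‖ ≤ ‖x‖ := by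
  have hm : 0 < max r ‖x‖ := lt_max_of_lt_left hr
  rw [radialRetraction, norm_smul, Real.norm_of_nonneg (by positivity)]
  exact mul_le_of_le_one_left (norm_nonneg _) ((div_le_one hm).2 (le_max_left _ _))

theorem norm_radialRetraction_le {r : ℝ} (hr : 0 < r) (x : E) : ‖radialRetraction r x‖ ≤ r := by
  have hm : 0 < max r ‖x‖ := lt_max_of_lt_left hr
  rw [radialRetraction, norm_smul, Real.norm_of_nonneg (by positivity), div_mul_eq_mul_div,
    div_le_iff₀ hm]
  exact mul_le_mul_of_nonneg_left (le_max_right _ _) hr.le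

/-- Picard–Lindelöf needs only some Lipschitz constant, and 2 is available in every normed space. -/
theorem norm_radialRetraction_sub_le {r : ℝ} (hr : 0 < r) (x y : E) :
    ‖radialRetraction r x - radialRetraction r y‖ ≤ 2 * ‖x - y‖ := by
  set a := max r ‖x‖ with ha
  set b := max r ‖y‖ with hb
  have ha0 : 0 < a := lt_max_of_lt_left hr
  have hb0 : 0 < b := lt_max_of_lt_left hr
  have hra : r ≤ a := le_max_left _ _
  have hyb : ‖y‖ ≤ b := le_max_right _ _
  have hab : |b - a| ≤ ‖x - y‖ := by
    rw [abs_sub_comm]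
    refine (abs_max_sub_max_le_max r ‖x‖ r ‖y‖).trans ?_
    simpa using abs_norm_sub_norm_le x y
  have key : radialRetraction r x - radialRetraction r y
      = (r / a) • (x - y) + ((r / a) * ((b - a) / b)) • y := by
    simp only [radialRetraction, ← ha, ← hb, smul_sub, sub_add]
    congr 1
    rw [← sub_smul]
    congr 1
    field_simp
    ring
  rw [key, two_mul]
  refine (norm_add_le _ _).trans (add_le_add ?_ ?_)
  · rw [norm_smul, Real.norm_of_nonneg (by positivity)]
    exact mul_le_of_le_one_left (norm_nonneg _) ((div_le_one ha0).2 hra)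
  · rw [norm_smul, norm_mul, Real.norm_of_nonneg (r := r / a) (by positivity),
      norm_div (b - a), Real.norm_of_nonneg hb0.le, Real.norm_eq_abs]
    have h1 : r / a ≤ 1 := (div_le_one ha0).2 hra
    have h2 : ‖y‖ / b ≤ 1 := (div_le_one hb0).2 hyb
    calc r / a * (|b - a| / b) * ‖y‖ = r / a * (|b - a| * (‖y‖ / b)) := by ring
      _ ≤ 1 * (‖x - y‖ * 1) := by gcongr
      _ = ‖x - y‖ := by ring

/-- Linear differential equations with continuous coefficients have solutions on `[0, 1]`. -/
theorem exists_linear_ode_solution [CompleteSpace E] {B : ℝ → E →L[ℝ] E}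
    (hB : ContinuousOn B (Icc 0 1)) (x₀ : E) :
    ∃ y : ℝ → E, y 0 = x₀ ∧ ∀ t ∈ Icc (0 : ℝ) 1, HasDerivWithinAt y (B t (y t)) (Icc 0 1) t := by
  obtain ⟨M, hM⟩ := isCompact_Icc.exists_bound_of_continuousOn hB
  have hM0 : 0 ≤ M := (norm_nonneg _).trans (hM 0 (by simp))
  -- Beyond the Gronwall bound at time 1. The field truncated at radius `r` is globally bounded by
  -- `M * r`, so one application of Picard–Lindelöf covers all of [0, 1].
  set r : ℝ := ‖x₀‖ * Real.exp M + 1 with hr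
  have hr0 : 0 < r := by positivity
  have hpl : IsPicardLindelof (fun t x => B t (radialRetraction r x))
      (⟨0, by simp⟩ : Icc (0 : ℝ) 1) x₀ (M * r).toNNReal 0 (M * r).toNNReal (M * 2).toNNReal := by
    refine ⟨fun t ht => ?_, fun x _ => hB.clm_apply continuousOn_const, fun t ht x _ => ?_, ?_⟩
    · refine LipschitzOnWith.of_dist_le_mul fun x _ y _ => ?_
      rw [dist_eq_norm, dist_eq_norm, ← map_sub, Real.coe_toNNReal _ (by positivity), mul_assoc]
      exact (B t).le_of_opNorm_le_of_le (hM t ht) (norm_radialRetraction_sub_le hr0 x y)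
    · rw [Real.coe_toNNReal _ (by positivity)]
      exact (B t).le_of_opNorm_le_of_le (hM t ht) (norm_radialRetraction_le hr0 x)
    · simp
  obtain ⟨y, hy0, hy⟩ := hpl.exists_eq_forall_mem_Icc_hasDerivWithinAt₀
  refine ⟨y, hy0, fun t ht => ?_⟩
  -- The retraction does not increase norms, so Gronwall holds for the truncated equation with the
  -- same `M`; hence the truncation is never active.
  have hbound : ‖y t‖ ≤ r := by
    have hg := norm_le_gronwallBound_of_norm_deriv_right_le (δ := ‖x₀‖) (K := M) (ε := 0)
      (fun s hs => (hy s hs).continuousWithinAt)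
      (fun s hs => (hy s (Ico_subset_Icc_self hs)).mono_of_mem_nhdsWithin
        (Icc_mem_nhdsGE_of_mem hs)) (by rw [← hy0])
      (fun s hs => by
        rw [add_zero]
        exact (B s).le_of_opNorm_le_of_le (hM s (Ico_subset_Icc_self hs))
          (norm_radialRetraction_le_norm hr0 _)) t ht
    rw [gronwallBound_ε0] at hg
    refine hg.trans ?_
    have : Real.exp (M * (t - 0)) ≤ Real.exp M :=
      Real.exp_le_exp.2 (by nlinarith [ht.1, ht.2])
    have := mul_le_mul_of_nonneg_left this (norm_nonneg x₀)
    linarith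
  have := hy t ht
  rwa [radialRetraction_eq_self hr0 hbound] at this

end LinearODE

/-! ### Parallel transport as a family of isometries -/

section Transport

variable {F : Type*} [NormedAddCommGroup F] [InnerProductSpace ℝ F]

/-- `A` is skew-adjoint. -/
def IsSkew (A : F →L[ℝ] F) : Prop := ∀ a b : F, inner ℝ (A a) b = -inner ℝ a (A b)

theorem IsSkew.inner_self {A : F →L[ℝ] F} (hA : IsSkew A) (v : F) : inner ℝ (A v) v = (0 : ℝ) := by
  have h := hA v v
  rw [real_inner_comm (A v) v] at h
  linarith

theorem IsSkew.inner_self' {A : F →L[ℝ] F} (hA : IsSkew A) (v : F) : inner ℝ v (A v) = (0 : ℝ) := by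
  rw [real_inner_comm, hA.inner_self]

/-- `P` is a solution of the parallel transport equation on `[0, 1]` with `P(1) = id`. -/
def SolvesTransport (A P : ℝ → F →L[ℝ] F) : Prop :=
  (∀ t ∈ Icc (0 : ℝ) 1, HasDerivWithinAt P (-((A t).comp (P t))) (Icc 0 1) t) ∧
    P 1 = ContinuousLinearMap.id ℝ F

/-- The reversal t ↦ 1 - t turns the final value problem into an initial value problem for left
multiplication by `A (1 - t)` on endomorphisms. -/
theorem exists_solvesTransport [CompleteSpace F] {A : ℝ → F →L[ℝ] F}
    (hA : ContinuousOn A (Icc 0 1)) : ∃ P, SolvesTransport A P := by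
  have hmaps : MapsTo (fun t : ℝ => 1 - t) (Icc 0 1) (Icc 0 1) := fun t ht =>
    ⟨by linarith [ht.2], by linarith [ht.1]⟩
  obtain ⟨y, hy0, hy⟩ := exists_linear_ode_solution
    (B := fun t => ContinuousLinearMap.compL ℝ F F F (A (1 - t)))
    ((ContinuousLinearMap.continuous _).comp_continuousOn
      (hA.comp (by fun_prop) hmaps)) (ContinuousLinearMap.id ℝ F)
  refine ⟨fun t => y (1 - t), fun t ht => ?_, by simpa using hy0⟩
  have h := (hy (1 - t) (hmaps ht)).scomp t
    ((hasDerivWithinAt_id t (Icc 0 1)).const_sub 1) hmaps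
  simpa [Function.comp_def] using h

/-- The derivative of |P v|² is -2⟨P v, A P v⟩, which vanishes by skewness; the value is read off at
t = 1. -/
theorem SolvesTransport.norm_apply {A P : ℝ → F →L[ℝ] F} (hP : SolvesTransport A P)
    (hA : ∀ t ∈ Icc (0 : ℝ) 1, IsSkew (A t)) {t : ℝ} (ht : t ∈ Icc (0 : ℝ) 1) (v : F) :
    ‖P t v‖ = ‖v‖ := by
  have hd : ∀ s ∈ Icc (0 : ℝ) 1,
      HasDerivWithinAt (fun s => ‖P s v‖ ^ 2) 0 (Icc 0 1) s := by
    intro s hs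
    have h1 : HasDerivWithinAt (fun s => P s v) (-(A s (P s v))) (Icc 0 1) s := by
      simpa using (hP.1 s hs).clm_apply (hasDerivWithinAt_const s (Icc 0 1) v)
    have h2 := h1.norm_sq
    simpa [(hA s hs).inner_self'] using h2
  have hc : ∀ x ∈ Icc (0 : ℝ) 1, ‖P x v‖ ^ 2 = ‖P 0 v‖ ^ 2 :=
    constant_of_has_deriv_right_zero (fun s hs => (hd s hs).continuousWithinAt)
      fun s hs => (hd s (Ico_subset_Icc_self hs)).mono_of_mem_nhdsWithin
        (Icc_mem_nhdsGE_of_mem hs)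
  have h := (hc t ht).trans (hc 1 (by simp)).symm
  rw [hP.2] at h
  exact (sq_eq_sq₀ (norm_nonneg _) (norm_nonneg _)).1 h

theorem SolvesTransport.inner_map_map {A P : ℝ → F →L[ℝ] F} (hP : SolvesTransport A P)
    (hA : ∀ t ∈ Icc (0 : ℝ) 1, IsSkew (A t)) {t : ℝ} (ht : t ∈ Icc (0 : ℝ) 1) (v w : F) :
    inner ℝ (P t v) (P t w) = (inner ℝ v w : ℝ) :=
  (LinearMap.norm_map_iff_inner_map_map (P t)).1 (fun v => hP.norm_apply hA ht v) v w

/-- Allows any vector to be extended to a parallel field along the segment, which is the test field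
of the duality arguments below. -/
theorem SolvesTransport.surjective [FiniteDimensional ℝ F] {A P : ℝ → F →L[ℝ] F}
    (hP : SolvesTransport A P) (hA : ∀ t ∈ Icc (0 : ℝ) 1, IsSkew (A t)) {t : ℝ}
    (ht : t ∈ Icc (0 : ℝ) 1) : Function.Surjective (P t) := by
  refine LinearMap.injective_iff_surjective (f := (P t : F →ₗ[ℝ] F)).1 fun v w h => ?_
  have h : P t v = P t w := h
  rw [← sub_eq_zero, ← norm_eq_zero, ← hP.norm_apply hA ht, map_sub, sub_eq_zero.2 h, norm_zero]

end Transport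

/-! ### Growth of the norm from covariant increments -/

section Growth

/-- A function whose increments are bounded to first order by a continuous function `M` has total
increments bounded by the integral of `M`. -/
theorem abs_sub_le_integral_of_eventually {f M : ℝ → ℝ} {c d : ℝ} (hcd : c ≤ d)
    (hM : ContinuousOn M (Icc c d))
    (hf : ∀ t₀ ∈ Icc c d, ∀ ε > 0, ∀ᶠ t in 𝓝[Icc c d] t₀,
      |f t - f t₀| ≤ |t - t₀| * (M t₀ + ε)) :
    |f d - f c| ≤ ∫ t in c..d, M t := by
  have hfc : ContinuousOn f (Icc c d) := by
    intro t₀ ht₀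
    have h0 : Tendsto (fun t => |t - t₀| * (M t₀ + 1)) (𝓝[Icc c d] t₀) (𝓝 0) := by
      have : Continuous fun t => |t - t₀| * (M t₀ + 1) := by fun_prop
      simpa using (this.tendsto t₀).mono_left nhdsWithin_le_nhds
    rw [ContinuousWithinAt, tendsto_iff_dist_tendsto_zero]
    exact squeeze_zero' (Eventually.of_forall fun _ => dist_nonneg)
      (by simpa [Real.dist_eq] using hf t₀ ht₀ 1 one_pos) h0
  have hMi : IntervalIntegrable M volume c d := by
    apply ContinuousOn.intervalIntegrable
    rwa [uIcc_of_le hcd]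
  have hB : ContinuousOn (fun x => ∫ t in c..x, M t) (Icc c d) := by
    have := intervalIntegral.continuousOn_primitive_interval (a := c) (b := d) (μ := volume)
      (f := M) (by rw [uIcc_of_le hcd]; exact hM.integrableOn_Icc)
    rwa [uIcc_of_le hcd] at this
  have hB' : ∀ x ∈ Ico c d, HasDerivWithinAt (fun x => ∫ t in c..x, M t) (M x) (Ici x) x := by
    intro x hx
    have hx' : Icc c d ∈ 𝓝[>] x := mem_of_superset (Ioc_mem_nhdsGT hx.2)
      fun y hy => ⟨hx.1.trans hy.1.le, hy.2⟩
    have hcx : Icc c x ⊆ Icc c d := Icc_subset_Icc_right hx.2.le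
    refine intervalIntegral.integral_hasDerivWithinAt_right (t := Ioi x)
      (ContinuousOn.intervalIntegrable (by rw [uIcc_of_le hx.1]; exact hM.mono hcx)) ?_
      ((hM x (Ico_subset_Icc_self hx)).mono_of_mem_nhdsWithin hx')
    exact ⟨Icc c d, hx', hM.aestronglyMeasurable measurableSet_Icc⟩
  -- One-sided comparison of upper right slopes with the derivative of the primitive of `M`; applied
  -- to `f` and to `-f`.
  have hone : ∀ g : ℝ → ℝ, ContinuousOn g (Icc c d) →
      (∀ t₀ ∈ Icc c d, ∀ ε > 0, ∀ᶠ t in 𝓝[Icc c d] t₀, |g t - g t₀| ≤ |t - t₀| * (M t₀ + ε)) →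
      g d - g c ≤ ∫ t in c..d, M t := by
    intro g hgc hg
    have h := image_le_of_liminf_slope_right_le_deriv_boundary (f := fun t => g t - g c)
      (hgc.sub continuousOn_const) (B := fun x => ∫ t in c..x, M t) (by simp) hB hB'
      (fun x hx r hr => by
        have hx' : Icc c d ∈ 𝓝[>] x := mem_of_superset (Ioc_mem_nhdsGT hx.2)
          fun y hy => ⟨hx.1.trans hy.1.le, hy.2⟩
        have h1 := (hg x (Ico_subset_Icc_self hx) ((r - M x) / 2) (by linarith)).filter_mono
          (le_inf (nhdsWithin_le_nhds) (le_principal_iff.2 hx'))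
        have h2 : ∀ᶠ z in 𝓝[>] x, slope (fun t => g t - g c) x z < r := by
          filter_upwards [h1, self_mem_nhdsWithin] with z hz hxz
          have hxz : 0 < z - x := sub_pos.2 hxz
          rw [slope_def_field, div_lt_iff₀ hxz]
          have := le_of_abs_le hz
          rw [abs_of_pos hxz] at this
          nlinarith
        exact h2.frequently)
    exact h (right_mem_Icc.2 hcd)
  rw [abs_le]
  refine ⟨?_, hone f hfc hf⟩
  have := hone (fun t => -f t) hfc.neg fun t₀ ht₀ ε hε => (hf t₀ ht₀ ε hε).mono fun t h => by
    rwa [← abs_neg, neg_sub_neg, neg_sub]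
  linarith

/-- As b v is orthogonal to v, |v + δ b v|² = |v|² + δ²|b v|². Together with the next lemma, a skew
correction affects the norm only at second order in δ. -/
theorem IsSkew.norm_le_norm_add_smul {F : Type*} [NormedAddCommGroup F] [InnerProductSpace ℝ F]
    {b : F →L[ℝ] F} (hb : IsSkew b) (δ : ℝ) (v : F) : ‖v‖ ≤ ‖v + δ • b v‖ := by
  have h := norm_add_sq_real v (δ • b v)
  rw [inner_smul_right, hb.inner_self'] at h
  refine (sq_le_sq₀ (norm_nonneg _) (norm_nonneg _)).1 ?_
  nlinarith [sq_nonneg ‖δ • b v‖]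

theorem IsSkew.norm_add_smul_le {F : Type*} [NormedAddCommGroup F] [InnerProductSpace ℝ F]
    {b : F →L[ℝ] F} (hb : IsSkew b) (δ : ℝ) (v : F) :
    ‖v + δ • b v‖ ≤ ‖v‖ + δ ^ 2 * ‖b‖ ^ 2 * ‖v‖ := by
  have h := norm_add_sq_real v (δ • b v)
  rw [inner_smul_right, hb.inner_self'] at h
  have h2 : ‖δ • b v‖ ^ 2 ≤ δ ^ 2 * ‖b‖ ^ 2 * ‖v‖ ^ 2 := by
    have h0 : ‖b v‖ ^ 2 ≤ ‖b‖ ^ 2 * ‖v‖ ^ 2 := by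
      rw [← mul_pow]
      gcongr
      exact b.le_opNorm v
    rw [norm_smul, mul_pow, Real.norm_eq_abs, sq_abs, mul_assoc]
    gcongr
  refine (sq_le_sq₀ (norm_nonneg _) (by positivity)).1 ?_
  have h3 : 0 ≤ δ ^ 2 * ‖b‖ ^ 2 * ‖v‖ ^ 2 := by positivity
  nlinarith [sq_nonneg (δ ^ 2 * ‖b‖ ^ 2 * ‖v‖)]

/-- The norm of a curve grows at most like the integral of a bound of its covariant derivative. -/
theorem abs_norm_sub_le_integral_of_eventually {F : Type*} [NormedAddCommGroup F]
    [InnerProductSpace ℝ F] {E : ℝ → F} {b : ℝ → F →L[ℝ] F} {M : ℝ → ℝ} {c d : ℝ} (hcd : c ≤ d)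
    (hM : ContinuousOn M (Icc c d)) (hb : ∀ t ∈ Icc c d, IsSkew (b t))
    (hE : ∀ t₀ ∈ Icc c d, ∀ ε > 0, ∀ᶠ t in 𝓝[Icc c d] t₀,
      ‖E t + (t - t₀) • b t₀ (E t) - E t₀‖ ≤ |t - t₀| * (M t₀ + ε)) :
    |‖E d‖ - ‖E c‖| ≤ ∫ t in c..d, M t := by
  refine abs_sub_le_integral_of_eventually (f := fun t => ‖E t‖) hcd hM fun t₀ ht₀ ε hε => ?_
  -- Bounds ‖E t‖ when |t - t₀| ≤ 1. The quadratic error of the skew correction is then o(|t - t₀|)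
  -- and takes half of `ε`, the hypothesis the other half.
  set K : ℝ := ‖E t₀‖ + (|M t₀| + ε / 2) with hK
  have hlim : ∀ k : ℝ, Tendsto (fun t => |t - t₀| * k) (𝓝[Icc c d] t₀) (𝓝 0) := fun k => by
    have : Continuous fun t => |t - t₀| * k := by fun_prop
    simpa using (this.tendsto t₀).mono_left nhdsWithin_le_nhds
  filter_upwards [hE t₀ ht₀ (ε / 2) (by positivity), (hlim 1).eventually_le_const one_pos,
    (hlim (‖b t₀‖ ^ 2 * K)).eventually_le_const (half_pos hε)] with t h1 h2 h3
  rw [mul_one] at h2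
  have hl := (hb t₀ ht₀).norm_le_norm_add_smul (t - t₀) (E t)
  have hu := (hb t₀ ht₀).norm_add_smul_le (t - t₀) (E t)
  set G := E t + (t - t₀) • b t₀ (E t)
  have hd := (abs_norm_sub_norm_le G (E t₀)).trans h1
  have hM1 : |t - t₀| * (M t₀ + ε / 2) ≤ 1 * (|M t₀| + ε / 2) := by
    have h0 := abs_nonneg (t - t₀)
    have h4 := le_abs_self (M t₀)
    have h5 := abs_nonneg (M t₀)
    nlinarith
  have hEK : ‖E t‖ ≤ K := by
    have := (abs_le.1 hd).2
    linarith
  have hsq : (t - t₀) ^ 2 * ‖b t₀‖ ^ 2 * ‖E t‖ ≤ |t - t₀| * (ε / 2) := by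
    calc (t - t₀) ^ 2 * ‖b t₀‖ ^ 2 * ‖E t‖
        = |t - t₀| * (|t - t₀| * (‖b t₀‖ ^ 2 * ‖E t‖)) := by rw [← sq_abs]; ring
      _ ≤ |t - t₀| * (|t - t₀| * (‖b t₀‖ ^ 2 * K)) := by gcongr
      _ ≤ |t - t₀| * (ε / 2) := by gcongr
  rw [abs_le] at hd ⊢
  constructor <;> nlinarith [hd.1, hd.2]

end Growth

/-! ### Covariant differences on a parallelogram -/

section Rectangle

variable {V : Type*} [NormedAddCommGroup V] [NormedSpace ℝ V] {Ω : Set V}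

theorem hasDerivWithinAt_comp_affine {W : Type*} [NormedAddCommGroup W] [NormedSpace ℝ W]
    {G : V → W} (hG : ContDiffOn ℝ 1 G Ω) {z e : V} {I : Set ℝ}
    (hI : ∀ t ∈ I, z + t • e ∈ Ω) {t : ℝ} (ht : t ∈ I) :
    HasDerivWithinAt (fun t : ℝ => G (z + t • e)) (fderivWithin ℝ G Ω (z + t • e) e) I t := by
  have h1 : HasDerivWithinAt (fun t : ℝ => z + t • e) e I t := by
    simpa using ((hasDerivWithinAt_id t I).smul_const e).const_add z
  exact ((hG.differentiableOn one_ne_zero _ (hI t ht)).hasFDerivWithinAt).comp_hasDerivWithinAt t h1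
    fun s hs => hI s hs

theorem continuousOn_comp_affine {W : Type*} [TopologicalSpace W]
    {G : V → W} (hG : ContinuousOn G Ω) {z e : V} {I : Set ℝ}
    (hI : ∀ t ∈ I, z + t • e ∈ Ω) : ContinuousOn (fun t : ℝ => G (z + t • e)) I :=
  hG.comp (by fun_prop) hI

theorem HasDerivWithinAt.eventually_norm_sub_le {W : Type*} [NormedAddCommGroup W]
    [NormedSpace ℝ W] {f : ℝ → W} {f' : W} {s : Set ℝ} {t₀ : ℝ} (hf : HasDerivWithinAt f f' s t₀)
    {ε : ℝ} (hε : 0 < ε) :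
    ∀ᶠ t in 𝓝[s] t₀, ‖f t - f t₀‖ ≤ |t - t₀| * (‖f'‖ + ε) := by
  filter_upwards [(hasDerivWithinAt_iff_isLittleO.1 hf).def hε] with t ht
  have : f t - f t₀ = (f t - f t₀ - (t - t₀) • f') + (t - t₀) • f' := by abel
  rw [this]
  refine (norm_add_le _ _).trans ?_
  rw [norm_smul]
  rw [Real.norm_eq_abs] at ht ⊢
  linarith

/-- Uniform continuity on the compact rectangle makes `δ` independent of the transversal parameter
`l`. -/
theorem IsCompact.eventually_forall_dist_lt {W : Type*} [PseudoMetricSpace W] {q : ℝ → ℝ → W}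
    {I J : Set ℝ} (hI : IsCompact I) (hJ : IsCompact J)
    (hq : ContinuousOn (fun x : ℝ × ℝ => q x.1 x.2) (I ×ˢ J)) {t₀ : ℝ} (ht₀ : t₀ ∈ J) {ε : ℝ}
    (hε : 0 < ε) :
    ∃ δ > 0, ∀ t ∈ J, |t - t₀| < δ → ∀ l ∈ I, dist (q l t) (q l t₀) < ε := by
  obtain ⟨δ, hδ, h⟩ := Metric.uniformContinuousOn_iff.1
    ((hI.prod hJ).uniformContinuousOn_of_continuous hq) ε hε
  refine ⟨δ, hδ, fun t ht htt l hl => h (l, t) ⟨hl, ht⟩ (l, t₀) ⟨hl, ht₀⟩ ?_⟩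
  simpa [Prod.dist_eq, Real.dist_eq, hδ] using htt

/-- First order Taylor expansion in one direction, uniformly along a transversal segment. -/
theorem eventually_forall_norm_taylor_le {W : Type*} [NormedAddCommGroup W] [NormedSpace ℝ W]
    {G : V → W} (hΩ : UniqueDiffOn ℝ Ω) (hG : ContDiffOn ℝ 1 G Ω) {x h e : V} {τ : ℝ}
    (hz : ∀ l ∈ Icc (0 : ℝ) 1, ∀ t ∈ Icc 0 τ, x + l • h + t • e ∈ Ω) {t₀ : ℝ}
    (ht₀ : t₀ ∈ Icc 0 τ) {ε : ℝ} (hε : 0 < ε) :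
    ∀ᶠ t in 𝓝[Icc 0 τ] t₀, ∀ l ∈ Icc (0 : ℝ) 1,
      ‖G (x + l • h + t • e) - G (x + l • h + t₀ • e)
        - (t - t₀) • fderivWithin ℝ G Ω (x + l • h + t₀ • e) e‖ ≤ ε * |t - t₀| := by
  obtain ⟨δ, hδ, hd⟩ := IsCompact.eventually_forall_dist_lt (I := Icc (0 : ℝ) 1) (J := Icc 0 τ)
    (q := fun l t => fderivWithin ℝ G Ω (x + l • h + t • e) e) isCompact_Icc isCompact_Icc
    (((hG.continuousOn_fderivWithin hΩ le_rfl).clm_apply continuousOn_const).comp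
      (by fun_prop) fun p hp => hz p.1 hp.1 p.2 hp.2) ht₀ hε
  filter_upwards [self_mem_nhdsWithin,
    mem_nhdsWithin_of_mem_nhds (Metric.ball_mem_nhds t₀ hδ)] with t ht htδ l hl
  -- A convex set on which the directional derivative stays within `ε` of its value `D` at `t₀`; the
  -- mean value inequality applies to G - s D.
  set S := Icc 0 τ ∩ Metric.ball t₀ δ with hS
  have hSc : Convex ℝ S := (convex_Icc _ _).inter (convex_ball _ _)
  set D := fderivWithin ℝ G Ω (x + l • h + t₀ • e) e
  have h1 : ∀ s ∈ S, HasDerivWithinAt (fun s : ℝ => G (x + l • h + s • e) - s • D)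
      (fderivWithin ℝ G Ω (x + l • h + s • e) e - D) S s := fun s hs => by
    have := hasDerivWithinAt_comp_affine hG (z := x + l • h) (e := e) (I := S)
      (fun s hs => hz l hl s hs.1) hs
    simpa using this.fun_sub ((hasDerivWithinAt_id s S).smul_const D)
  have h2 := hSc.norm_image_sub_le_of_norm_hasDerivWithin_le (C := ε) h1
    (fun s hs => by
      rw [← dist_eq_norm]
      exact (hd s hs.1 (by simpa [Real.dist_eq] using hs.2) l hl).le)
    (⟨ht₀, Metric.mem_ball_self hδ⟩ : t₀ ∈ S) ⟨ht, htδ⟩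
  rw [Real.norm_eq_abs] at h2
  convert h2 using 2
  rw [sub_smul]
  abel

variable {F : Type*} [NormedAddCommGroup F] [InnerProductSpace ℝ F]
  {Γ : V → V →L[ℝ] (F →L[ℝ] F)} {U : V → F}

theorem IsC1ConnectionForm.isSkew (hΓ : IsC1ConnectionForm Ω Γ) {z : V} (hz : z ∈ Ω) (v : V) :
    IsSkew (Γ z v) := hΓ.2 z hz v

theorem continuousOn_covDeriv (hΩ : UniqueDiffOn ℝ Ω) (hΓ : ContDiffOn ℝ 1 Γ Ω)
    (hU : ContDiffOn ℝ 1 U Ω) : ContinuousOn (covDeriv Ω Γ U) Ω := by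
  unfold covDeriv
  refine (hU.continuousOn_fderivWithin hΩ le_rfl).add (ContinuousOn.clm_apply ?_ hU.continuousOn)
  exact (ContinuousLinearMap.flipₗᵢ ℝ V F F).continuous.comp_continuousOn hΓ.continuousOn

/-- With `Γ` frozen at `t₀`, the derivative of U + (t - t₀) Γ U at `t₀` is the covariant derivative;
no regularity of `Γ` enters. -/
theorem eventually_norm_covariant_increment_le (hU : ContDiffOn ℝ 1 U Ω) {z e : V} {c d : ℝ}
    (hz : ∀ t ∈ Icc c d, z + t • e ∈ Ω) {t₀ : ℝ} (ht₀ : t₀ ∈ Icc c d) {ε : ℝ} (hε : 0 < ε) :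
    ∀ᶠ t in 𝓝[Icc c d] t₀,
      ‖U (z + t • e) + (t - t₀) • Γ (z + t₀ • e) e (U (z + t • e)) - U (z + t₀ • e)‖
        ≤ |t - t₀| * (‖covDeriv Ω Γ U (z + t₀ • e) e‖ + ε) := by
  have h1 := hasDerivWithinAt_comp_affine hU hz ht₀
  have h2 : HasDerivWithinAt (fun t : ℝ => Γ (z + t₀ • e) e (U (z + t • e)))
      (Γ (z + t₀ • e) e (fderivWithin ℝ U Ω (z + t₀ • e) e)) (Icc c d) t₀ := by
    simpa using (hasDerivWithinAt_const t₀ (Icc c d) (Γ (z + t₀ • e) e)).clm_apply h1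
  have h3 := h1.add (((hasDerivWithinAt_id t₀ (Icc c d)).sub_const t₀).smul h2)
  have h4 := HasDerivWithinAt.eventually_norm_sub_le h3 hε
  simpa [covDeriv] using h4

/-- The diamagnetic inequality along a segment. -/
theorem abs_norm_sub_norm_le_integral_covDeriv (hΩ : UniqueDiffOn ℝ Ω)
    (hΓ : IsC1ConnectionForm Ω Γ) (hU : ContDiffOn ℝ 1 U Ω) {z e : V} {c d : ℝ} (hcd : c ≤ d)
    (hz : ∀ t ∈ Icc c d, z + t • e ∈ Ω) :
    |‖U (z + d • e)‖ - ‖U (z + c • e)‖| ≤ ∫ t in c..d, ‖covDeriv Ω Γ U (z + t • e) e‖ :=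
  abs_norm_sub_le_integral_of_eventually (E := fun t => U (z + t • e))
    (b := fun t => Γ (z + t • e) e) hcd
    ((continuousOn_comp_affine (continuousOn_covDeriv hΩ hΓ.1 hU) hz).clm_apply
      continuousOn_const).norm
    (fun t ht => hΓ.isSkew (hz t ht) e)
    fun _ ht₀ _ hε => eventually_norm_covariant_increment_le hU hz ht₀ hε

theorem norm_curvature_le {β : ℝ≥0} (hβ : curvatureNorm Ω Γ ≤ β) {z : V}
    (hz : z ∈ Ω) (v w : V) : ‖curvature Ω Γ z v w‖ ≤ β * (‖v‖ * ‖w‖) := by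
  by_cases hv : v = 0
  · simp [hv, curvature]
  by_cases hw : w = 0
  · simp [hw, curvature]
  have h : ‖curvature Ω Γ z v w‖ₑ / (‖v‖ₑ * ‖w‖ₑ) ≤ β :=
    le_trans (le_iSup₂_of_le z hz
      (le_iSup₂ (f := fun v w => ‖curvature Ω Γ z v w‖ₑ / (‖v‖ₑ * ‖w‖ₑ)) v w)) hβ
  rw [ENNReal.div_le_iff (by simp [hv, hw]) (ENNReal.mul_ne_top enorm_ne_top enorm_ne_top)] at h
  simp only [enorm_eq_nnnorm] at h
  exact_mod_cast h

/-- Covariant differences along a segment are controlled by the covariant derivative. -/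
theorem norm_sub_transport_le_integral [FiniteDimensional ℝ F] (hΩ : UniqueDiffOn ℝ Ω)
    (hΓ : IsC1ConnectionForm Ω Γ) (hU : ContDiffOn ℝ 1 U Ω) {z h : V}
    (hz : ∀ t ∈ Icc (0 : ℝ) 1, z + t • h ∈ Ω) {P : ℝ → F →L[ℝ] F}
    (hP : SolvesTransport (fun t => Γ (z + t • h) h) P) :
    ‖U z - P 0 (U (z + h))‖ ≤ ∫ t in (0 : ℝ)..1, ‖covDeriv Ω Γ U (z + t • h) h‖ := by
  have hs : ∀ t ∈ Icc (0 : ℝ) 1, IsSkew (Γ (z + t • h) h) := fun t ht => hΓ.isSkew (hz t ht) h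
  set y := U z - P 0 (U (z + h)) with hy
  -- Duality: `y` is tested against the parallel field P t w that equals `y` at 0. The pairing with
  -- `U` has derivative ⟨P w, D_Γ U⟩, and by isometry its endpoint values differ by exactly ‖y‖².
  obtain ⟨w, hw⟩ := hP.surjective hs (left_mem_Icc.2 zero_le_one) y
  have hwy : ‖w‖ = ‖y‖ := by rw [← hw, hP.norm_apply hs (left_mem_Icc.2 zero_le_one)]
  have hder : ∀ t ∈ Icc (0 : ℝ) 1, HasDerivWithinAt (fun t => inner ℝ (P t w) (U (z + t • h)))
      (inner ℝ (P t w) (covDeriv Ω Γ U (z + t • h) h)) (Icc 0 1) t := fun t ht => by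
    have h1 : HasDerivWithinAt (fun s => P s w) (-(Γ (z + t • h) h (P t w))) (Icc 0 1) t := by
      simpa using (hP.1 t ht).clm_apply (hasDerivWithinAt_const t (Icc 0 1) w)
    have h2 := h1.inner ℝ (hasDerivWithinAt_comp_affine hU hz ht)
    refine h2.congr_deriv ?_
    simp [covDeriv, inner_add_right, inner_neg_left, hs t ht (P t w)]
  have hint := abs_sub_le_integral_of_eventually (f := fun t => inner ℝ (P t w) (U (z + t • h)))
    (M := fun t => ‖w‖ * ‖covDeriv Ω Γ U (z + t • h) h‖) zero_le_one
    (continuousOn_const.mul ((continuousOn_comp_affine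
      (continuousOn_covDeriv hΩ hΓ.1 hU) hz).clm_apply continuousOn_const).norm)
    fun t₀ ht₀ ε hε => by
      filter_upwards [HasDerivWithinAt.eventually_norm_sub_le (hder t₀ ht₀) hε] with t ht
      rw [Real.norm_eq_abs] at ht
      refine ht.trans ?_
      gcongr
      refine (norm_inner_le_norm _ _).trans ?_
      rw [hP.norm_apply hs ht₀]
  simp only [intervalIntegral.integral_const_mul, one_smul, zero_smul, add_zero, hP.2,
    ContinuousLinearMap.id_apply] at hint
  rw [← hP.inner_map_map hs (left_mem_Icc.2 zero_le_one), hw, hwy, ← inner_sub_right,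
    ← neg_sub, ← hy, inner_neg_right, abs_neg, real_inner_self_eq_norm_sq,
    abs_of_nonneg (sq_nonneg _), sq] at hint
  rcases (norm_nonneg y).eq_or_lt with h0 | h0
  · rw [← h0]
    exact intervalIntegral.integral_nonneg zero_le_one fun _ _ => norm_nonneg _
  · exact le_of_mul_le_mul_left hint h0

/-- Two transports along nearby parallel segments differ, up to first order, by the curvature. -/
theorem eventually_norm_transport_sub_le [FiniteDimensional ℝ F] (hΩ : UniqueDiffOn ℝ Ω)
    (hΓ : IsC1ConnectionForm Ω Γ) {x h e : V} {τ κ : ℝ}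
    (hz : ∀ l ∈ Icc (0 : ℝ) 1, ∀ t ∈ Icc 0 τ, x + l • h + t • e ∈ Ω)
    (hκ : ∀ z ∈ Ω, ‖curvature Ω Γ z h e‖ ≤ κ) {P : ℝ → ℝ → F →L[ℝ] F}
    (hP : ∀ t ∈ Icc 0 τ, SolvesTransport (fun l => Γ (x + l • h + t • e) h) (P t))
    {t₀ : ℝ} (ht₀ : t₀ ∈ Icc 0 τ) {ε : ℝ} (hε : 0 < ε) :
    ∀ᶠ t in 𝓝[Icc 0 τ] t₀, ∀ v : F,
      ‖P t 0 v + (t - t₀) • Γ (x + t₀ • e) e (P t 0 v)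
        - P t₀ 0 (v + (t - t₀) • Γ (x + h + t₀ • e) e v)‖ ≤ |t - t₀| * (κ + ε) * ‖v‖ := by
  have hs : ∀ t ∈ Icc 0 τ, ∀ l ∈ Icc (0 : ℝ) 1, IsSkew (Γ (x + l • h + t • e) h) :=
    fun t ht l hl => hΓ.isSkew (hz l hl t ht) h
  obtain ⟨B, hB⟩ := isCompact_Icc.exists_bound_of_continuousOn
    (f := fun l : ℝ => Γ (x + l • h + t₀ • e) e) (s := Icc (0 : ℝ) 1)
    ((hΓ.1.continuousOn.comp (by fun_prop) fun l hl => hz l hl t₀ ht₀).clm_apply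
      continuousOn_const)
  have hB0 : 0 ≤ B := (norm_nonneg _).trans (hB 0 (by simp))
  -- Half of `ε` is for the variation of Γ[h] composed with Γ[e], which is bounded by `B`; the other
  -- half is for the Taylor remainder of `Γ` evaluated at `h`.
  obtain ⟨δ, hδ, hd⟩ := IsCompact.eventually_forall_dist_lt (I := Icc (0 : ℝ) 1) (J := Icc 0 τ)
    (q := fun l t => Γ (x + l • h + t • e) h) isCompact_Icc isCompact_Icc
    ((hΓ.1.continuousOn.clm_apply continuousOn_const).comp
      (by fun_prop) fun p hp => hz p.1 hp.1 p.2 hp.2) ht₀ (ε := ε / 2 / (B + 1)) (by positivity)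
  have hh : 0 < ε / 2 / (‖h‖ + 1) := by positivity
  filter_upwards [self_mem_nhdsWithin,
    mem_nhdsWithin_of_mem_nhds (Metric.ball_mem_nhds t₀ hδ),
    eventually_forall_norm_taylor_le hΩ hΓ.1 hz ht₀ hh] with t ht htδ htay v
  have hz' : ∀ l ∈ Icc (0 : ℝ) 1, x + t₀ • e + l • h ∈ Ω := fun l hl => by
    rw [add_right_comm]
    exact hz l hl t₀ ht₀
  set s := t - t₀ with hs_def
  set y := P t 0 v + s • Γ (x + t₀ • e) e (P t 0 v) - P t₀ 0 (v + s • Γ (x + h + t₀ • e) e v)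
    with hy
  have h01 : (0 : ℝ) ∈ Icc (0 : ℝ) 1 := by simp
  have h11 : (1 : ℝ) ∈ Icc (0 : ℝ) 1 := by simp
  obtain ⟨w, hw⟩ := (hP t₀ ht₀).surjective (hs t₀ ht₀) h01 y
  have hwy : ‖w‖ = ‖y‖ := by rw [← hw, (hP t₀ ht₀).norm_apply (hs t₀ ht₀) h01]
  -- Both transports are the identity at l = 1, so the values of `φ` at 0 and 1 differ by ‖y‖², and
  -- `y` is estimated by duality once more.
  set φ : ℝ → ℝ := fun l =>
    inner ℝ (P t₀ l w) (P t l v + s • Γ (x + l • h + t₀ • e) e (P t l v)) with hφ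
  -- Differentiating `φ` in `l` yields the curvature at height `t₀`, a Taylor remainder of Γ[h] in
  -- direction `e`, and Γ[e] times the increment of Γ[h]; the last two are o(s) uniformly in `l`.
  set Q : ℝ → F →L[ℝ] F := fun l =>
    s • curvature Ω Γ (x + l • h + t₀ • e) h e
      - (Γ (x + l • h + t • e) - Γ (x + l • h + t₀ • e)
        - s • fderivWithin ℝ Γ Ω (x + l • h + t₀ • e) e) h
      - s • (Γ (x + l • h + t₀ • e) e).comp
        (Γ (x + l • h + t • e) h - Γ (x + l • h + t₀ • e) h) with hQ
  have hder : ∀ l ∈ Icc (0 : ℝ) 1,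
      HasDerivWithinAt φ (inner ℝ (P t₀ l w) (Q l (P t l v))) (Icc 0 1) l := fun l hl => by
    have h1 : HasDerivWithinAt (fun l => P t₀ l w)
        (-(Γ (x + l • h + t₀ • e) h (P t₀ l w))) (Icc 0 1) l := by
      simpa using ((hP t₀ ht₀).1 l hl).clm_apply (hasDerivWithinAt_const l (Icc 0 1) w)
    have h2 : HasDerivWithinAt (fun l => P t l v)
        (-(Γ (x + l • h + t • e) h (P t l v))) (Icc 0 1) l := by
      simpa using ((hP t ht).1 l hl).clm_apply (hasDerivWithinAt_const l (Icc 0 1) v)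
    have h3 : HasDerivWithinAt (fun l : ℝ => Γ (x + l • h + t₀ • e) e)
        (fderivWithin ℝ Γ Ω (x + l • h + t₀ • e) h e) (Icc 0 1) l := by
      have h4 := hasDerivWithinAt_comp_affine hΓ.1 hz' hl
      simp only [add_right_comm x (t₀ • e)] at h4
      simpa using h4.clm_apply (hasDerivWithinAt_const l (Icc 0 1) e)
    have h5 := h1.inner ℝ (h2.fun_add ((h3.clm_apply h2).fun_const_smul s))
    refine h5.congr_deriv ?_
    rw [inner_neg_left, hs t₀ ht₀ l hl, neg_neg, ← inner_add_right]
    congr 1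
    simp only [hQ, curvature, sub_apply, add_apply,
      smul_apply, ContinuousLinearMap.comp_apply, map_add, map_sub, map_neg,
      map_smul, smul_add, smul_sub, smul_neg]
    abel
  have hQn : ∀ l ∈ Icc (0 : ℝ) 1, ‖Q l‖ ≤ |s| * (κ + ε) := fun l hl => by
    have hz₀ := hz l hl t₀ ht₀
    have e1 : ‖s • curvature Ω Γ (x + l • h + t₀ • e) h e‖ ≤ |s| * κ := by
      rw [norm_smul, Real.norm_eq_abs]
      gcongr
      exact hκ _ hz₀
    have e2 : ‖(Γ (x + l • h + t • e) - Γ (x + l • h + t₀ • e)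
        - s • fderivWithin ℝ Γ Ω (x + l • h + t₀ • e) e) h‖ ≤ |s| * (ε / 2) := by
      refine (ContinuousLinearMap.le_opNorm _ _).trans
        ((mul_le_mul_of_nonneg_right (htay l hl) (norm_nonneg h)).trans ?_)
      have : ε / 2 / (‖h‖ + 1) * ‖h‖ ≤ ε / 2 := by
        rw [div_mul_eq_mul_div, div_le_iff₀ (by positivity)]
        nlinarith [norm_nonneg h]
      nlinarith [abs_nonneg s]
    have e3 : ‖s • (Γ (x + l • h + t₀ • e) e).comp
        (Γ (x + l • h + t • e) h - Γ (x + l • h + t₀ • e) h)‖ ≤ |s| * (ε / 2) := by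
      rw [norm_smul, Real.norm_eq_abs]
      gcongr
      refine (ContinuousLinearMap.opNorm_comp_le _ _).trans ?_
      have h6 := (hd t ht (by simpa [Real.dist_eq] using htδ) l hl).le
      rw [dist_eq_norm] at h6
      refine (mul_le_mul (hB l hl) h6 (norm_nonneg _) hB0).trans ?_
      rw [mul_div_assoc', div_le_iff₀ (by positivity)]
      nlinarith
    refine (norm_sub_le _ _).trans ?_
    have := norm_sub_le (s • curvature Ω Γ (x + l • h + t₀ • e) h e)
      ((Γ (x + l • h + t • e) - Γ (x + l • h + t₀ • e)
        - s • fderivWithin ℝ Γ Ω (x + l • h + t₀ • e) e) h)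
    linarith
  have hmv := (convex_Icc (0 : ℝ) 1).norm_image_sub_le_of_norm_hasDerivWithin_le
    (C := ‖y‖ * (|s| * (κ + ε) * ‖v‖)) hder (fun l hl => by
      refine (norm_inner_le_norm _ _).trans ?_
      rw [(hP t₀ ht₀).norm_apply (hs t₀ ht₀) hl, hwy]
      gcongr
      refine (Q l).le_of_opNorm_le_of_le (hQn l hl) ?_
      rw [(hP t ht).norm_apply (hs t ht) hl]) h11 h01
  simp only [hφ, zero_smul, one_smul, add_zero, (hP t ht).2, (hP t₀ ht₀).2,
    ContinuousLinearMap.id_apply, hw] at hmv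
  rw [← (hP t₀ ht₀).inner_map_map (hs t₀ ht₀) h01 w, hw, ← inner_sub_right, ← hy,
    real_inner_self_eq_norm_sq, Real.norm_of_nonneg (sq_nonneg _)] at hmv
  norm_num at hmv
  rcases (norm_nonneg y).eq_or_lt with h0 | h0
  · rw [← h0]
    have := (norm_nonneg _).trans (hQn 0 h01)
    positivity
  · rw [sq] at hmv
    exact le_of_mul_le_mul_left hmv h0

/-- The covariant difference along a side of a parallelogram is controlled by the covariant
derivative along the three other sides and by the curvature. -/
theorem norm_sub_transport_le [FiniteDimensional ℝ F] (hΩ : UniqueDiffOn ℝ Ω)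
    (hΓ : IsC1ConnectionForm Ω Γ) (hU : ContDiffOn ℝ 1 U Ω) {x h e : V} {τ κ : ℝ} (hτ : 0 ≤ τ)
    (hz : ∀ l ∈ Icc (0 : ℝ) 1, ∀ t ∈ Icc 0 τ, x + l • h + t • e ∈ Ω)
    (hκ : ∀ z ∈ Ω, ‖curvature Ω Γ z h e‖ ≤ κ) {R : ℝ → F →L[ℝ] F}
    (hR : SolvesTransport (fun l => Γ (x + l • h) h) R) :
    ‖U x - R 0 (U (x + h))‖ ≤ (∫ l in (0 : ℝ)..1, ‖covDeriv Ω Γ U (x + l • h + τ • e) h‖)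
      + ∫ t in (0 : ℝ)..τ, (‖covDeriv Ω Γ U (x + t • e) e‖ + ‖covDeriv Ω Γ U (x + h + t • e) e‖
        + κ * ‖U (x + h + t • e)‖) := by
  have := FiniteDimensional.complete ℝ F
  have h01 : (0 : ℝ) ∈ Icc (0 : ℝ) 1 := by simp
  have h11 : (1 : ℝ) ∈ Icc (0 : ℝ) 1 := by simp
  have hz0 : ∀ t ∈ Icc 0 τ, x + t • e ∈ Ω := fun t ht => by simpa using hz 0 h01 t ht
  have hz1 : ∀ t ∈ Icc 0 τ, x + h + t • e ∈ Ω := fun t ht => by simpa using hz 1 h11 t ht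
  -- The choice at t = 0 is forced to be the given `R`, so uniqueness of transports is never needed.
  have hex : ∀ t ∈ Icc 0 τ, ∃ P : ℝ → F →L[ℝ] F,
      SolvesTransport (fun l => Γ (x + l • h + t • e) h) P ∧ (t = 0 → P = R) := by
    intro t ht
    by_cases h0 : t = 0
    · exact ⟨R, by simpa [h0] using hR, fun _ => rfl⟩
    · obtain ⟨P, hP⟩ := exists_solvesTransport (A := fun l => Γ (x + l • h + t • e) h)
        ((hΓ.1.continuousOn.comp (by fun_prop) fun l hl => hz l hl t ht).clm_apply
          continuousOn_const)
      exact ⟨P, hP, fun h => absurd h h0⟩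
  choose! P hP hPR using hex
  have hs : ∀ t ∈ Icc 0 τ, ∀ l ∈ Icc (0 : ℝ) 1, IsSkew (Γ (x + l • h + t • e) h) :=
    fun t ht l hl => hΓ.isSkew (hz l hl t ht) h
  have hκ0 : 0 ≤ κ := (norm_nonneg _).trans (hκ _ (hz0 0 (left_mem_Icc.2 hτ)))
  have hD := continuousOn_covDeriv hΩ hΓ.1 hU
  have hvert := abs_norm_sub_le_integral_of_eventually
    (E := fun t => U (x + t • e) - P t 0 (U (x + h + t • e)))
    (b := fun t => Γ (x + t • e) e)
    (M := fun t => ‖covDeriv Ω Γ U (x + t • e) e‖ + ‖covDeriv Ω Γ U (x + h + t • e) e‖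
        + κ * ‖U (x + h + t • e)‖) hτ
    (((((continuousOn_comp_affine hD hz0).clm_apply continuousOn_const).norm).add
      ((continuousOn_comp_affine hD hz1).clm_apply continuousOn_const).norm).add
      (continuousOn_const.mul (continuousOn_comp_affine hU.continuousOn hz1).norm))
    (fun t ht => hΓ.isSkew (hz0 t ht) e) fun t₀ ht₀ ε hε => by
      set N : ℝ := ‖U (x + h + t₀ • e)‖ with hN
      -- Three errors of size at most ε/4 each; the product form accounts for ‖U‖ being evaluated at
      -- `t` instead of `t₀` in the curvature term.
      obtain ⟨η, hη, hη1, hη2⟩ : ∃ η > 0, η ≤ ε / 4 ∧ (κ + η) * (N + η) ≤ κ * N + ε / 4 := by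
        have hc : Tendsto (fun η : ℝ => (κ + η) * (N + η)) (𝓝[>] 0) (𝓝 (κ * N)) := by
          have : Continuous fun η : ℝ => (κ + η) * (N + η) := by fun_prop
          simpa using (this.tendsto 0).mono_left nhdsWithin_le_nhds
        have h1 := hc.eventually_le_const (show κ * N < κ * N + ε / 4 by linarith)
        have h2 : ∀ᶠ η : ℝ in 𝓝[>] 0, η ≤ ε / 4 :=
          nhdsWithin_le_nhds (Iic_mem_nhds (by positivity))
        obtain ⟨η, h3, h4, h5⟩ := (h1.and (h2.and self_mem_nhdsWithin)).exists
        exact ⟨η, h5, h4, h3⟩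
      have hcont : Tendsto (fun t => ‖U (x + h + t • e)‖) (𝓝[Icc 0 τ] t₀) (𝓝 N) :=
        ((continuousOn_comp_affine hU.continuousOn hz1).norm t₀ ht₀).tendsto
      filter_upwards [self_mem_nhdsWithin,
        eventually_norm_covariant_increment_le (Γ := Γ) hU hz0 ht₀ hη,
        eventually_norm_covariant_increment_le (Γ := Γ) hU hz1 ht₀ hη,
        eventually_norm_transport_sub_le hΩ hΓ hz hκ hP ht₀ hη,
        hcont.eventually_le_const (show N < N + η by linarith)] with t ht i1 i2 i3 i4
      have i3 := i3 (U (x + h + t • e))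
      -- Covariant increment of `U` over `x`, minus the transported one over x + h, minus the
      -- variation of the transport. The last is applied to a vector depending on `t`, hence the
      -- uniformity in `v` of the transport lemma.
      have hsplit : U (x + t • e) - P t 0 (U (x + h + t • e))
          + (t - t₀) • Γ (x + t₀ • e) e (U (x + t • e) - P t 0 (U (x + h + t • e)))
          - (U (x + t₀ • e) - P t₀ 0 (U (x + h + t₀ • e)))
          = (U (x + t • e) + (t - t₀) • Γ (x + t₀ • e) e (U (x + t • e)) - U (x + t₀ • e))
          - P t₀ 0 (U (x + h + t • e) + (t - t₀) • Γ (x + h + t₀ • e) e (U (x + h + t • e))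
              - U (x + h + t₀ • e))
          - (P t 0 (U (x + h + t • e))
              + (t - t₀) • Γ (x + t₀ • e) e (P t 0 (U (x + h + t • e)))
              - P t₀ 0 (U (x + h + t • e)
                + (t - t₀) • Γ (x + h + t₀ • e) e (U (x + h + t • e)))) := by
        simp only [map_sub, smul_sub]
        abel
      rw [hsplit]
      refine (norm_sub_le _ _).trans ((add_le_add_left (norm_sub_le _ _) _).trans ?_)
      rw [(hP t₀ ht₀).norm_apply (hs t₀ ht₀) h01]
      have i5 : |t - t₀| * (κ + η) * ‖U (x + h + t • e)‖ ≤ |t - t₀| * (κ * N + ε / 4) := by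
        rw [mul_assoc]
        refine mul_le_mul_of_nonneg_left (le_trans ?_ hη2) (abs_nonneg _)
        gcongr
      have i6 := mul_le_mul_of_nonneg_left hη1 (abs_nonneg (t - t₀))
      nlinarith [abs_nonneg (t - t₀)]
  have hz2 : ∀ l ∈ Icc (0 : ℝ) 1, x + τ • e + l • h ∈ Ω := fun l hl => by
    rw [add_right_comm]
    exact hz l hl τ (right_mem_Icc.2 hτ)
  have hhor := norm_sub_transport_le_integral hΩ hΓ hU hz2 (P := P τ) (by
    have := hP τ (right_mem_Icc.2 hτ)
    simpa only [add_right_comm x (τ • e)] using this)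
  simp only [add_right_comm x (τ • e)] at hhor
  simp only [hPR 0 (left_mem_Icc.2 hτ) rfl, zero_smul, add_zero] at hvert
  have := (abs_le.1 hvert).1
  linarith

end Rectangle

/-! ### Weighted inequalities on the half-line -/

section OneDimensional

/-- Hölder's inequality against the constant 1: Jensen without normalising the measure. -/
theorem rpow_lintegral_le {α : Type*} [MeasurableSpace α] {ν : Measure α} {p : ℝ} (hp : 1 ≤ p)
    {g : α → ℝ≥0∞} (hg : AEMeasurable g ν) :
    (∫⁻ a, g a ∂ν) ^ p ≤ ν univ ^ (p - 1) * ∫⁻ a, g a ^ p ∂ν := by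
  have hp0 : 0 < p := by linarith
  have h := eLpNorm_le_eLpNorm_mul_rpow_measure_univ (μ := ν) (f := g) (p := 1)
    (q := ENNReal.ofReal p) (by simpa using ENNReal.ofReal_le_ofReal hp) hg.aestronglyMeasurable
  rw [eLpNorm_one_eq_lintegral_enorm, eLpNorm_eq_lintegral_rpow_enorm_toReal (by simpa using hp0)
    (by simp), ENNReal.toReal_ofReal hp0.le] at h
  simp only [enorm_eq_self, ENNReal.toReal_one] at h
  calc (∫⁻ a, g a ∂ν) ^ p
      ≤ ((∫⁻ a, g a ^ p ∂ν) ^ (1 / p) * ν univ ^ (1 / 1 - 1 / p)) ^ p := by gcongr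
    _ = ν univ ^ (p - 1) * ∫⁻ a, g a ^ p ∂ν := by
      rw [ENNReal.mul_rpow_of_nonneg _ _ hp0.le, ← ENNReal.rpow_mul, ← ENNReal.rpow_mul, mul_comm]
      congr 2
      · field_simp
      · field_simp
        simp

theorem ofReal_rpow_mul_ofReal_rpow {t : ℝ} (ht : 0 < t) (a b : ℝ) :
    ENNReal.ofReal (t ^ a) * ENNReal.ofReal (t ^ b) = ENNReal.ofReal (t ^ (a + b)) := by
  rw [← ENNReal.ofReal_mul (by positivity), Real.rpow_add ht]

theorem lintegral_Ioc_rpow {a T : ℝ} (ha : 0 < a) (hT : 0 ≤ T) :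
    ∫⁻ t in Ioc 0 T, ENNReal.ofReal (t ^ (a - 1)) = ENNReal.ofReal (T ^ a / a) := by
  have hi : IntervalIntegrable (fun t : ℝ => t ^ (a - 1)) volume 0 T :=
    intervalIntegral.intervalIntegrable_rpow' (by linarith)
  rw [← ofReal_integral_eq_lintegral_ofReal hi.1 ?_, ← intervalIntegral.integral_of_le hT,
    integral_rpow (Or.inl (by linarith))]
  · simp [ha.ne']
  · filter_upwards [ae_restrict_mem measurableSet_Ioc] with t ht
    exact Real.rpow_nonneg ht.1.le _

theorem lintegral_Ioi_rpow {a T : ℝ} (ha : 0 < a) (hT : 0 < T) :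
    ∫⁻ t in Ioi T, ENNReal.ofReal (t ^ (-1 - a)) = ENNReal.ofReal (T ^ (-a) / a) := by
  rw [← ofReal_integral_eq_lintegral_ofReal (integrableOn_Ioi_rpow_of_lt (by linarith) hT) ?_,
    integral_Ioi_rpow_of_lt (by linarith) hT]
  · congr 1
    rw [show -1 - a + 1 = -a by ring, neg_div_neg_eq]
  · filter_upwards [ae_restrict_mem measurableSet_Ioi] with t ht
    exact Real.rpow_nonneg (hT.trans ht).le _

/-- A weighted form of Jensen's inequality on `(0, r]`. -/
theorem rpow_lintegral_Ioc_le {s p : ℝ} (hs : 0 < s) (hp : 1 ≤ p) {g : ℝ → ℝ≥0∞}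
    (hg : Measurable g) {r : ℝ} (hr : 0 ≤ r) :
    (∫⁻ t in Ioc 0 r, g t) ^ p ≤ ENNReal.ofReal (r ^ s / s) ^ (p - 1)
      * ∫⁻ t in Ioc 0 r, g t ^ p * ENNReal.ofReal (t ^ ((1 - s) * p + s - 1)) := by
  have hp0 : 0 < p := by linarith
  have hw : ∀ a : ℝ, Measurable fun t : ℝ => ENNReal.ofReal (t ^ a) := fun a => by fun_prop
  -- Jensen for g t^(1-s) against t^(s-1) dt, of mass r^s / s; the exponents add up to (1 - s)p + s
  -- - 1.
  set ν := (volume.restrict (Ioc 0 r)).withDensity fun t : ℝ => ENNReal.ofReal (t ^ (s - 1))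
  have h := rpow_lintegral_le (ν := ν) hp (g := fun t => g t * ENNReal.ofReal (t ^ (1 - s)))
    (hg.mul (hw _)).aemeasurable
  have hν : ν univ = ENNReal.ofReal (r ^ s / s) := by
    rw [withDensity_apply _ .univ, Measure.restrict_univ, lintegral_Ioc_rpow hs hr]
  have hgw : Measurable fun t => g t * ENNReal.ofReal (t ^ (1 - s)) := hg.mul (hw _)
  rw [hν, lintegral_withDensity_eq_lintegral_mul _ (hw _) hgw,
    lintegral_withDensity_eq_lintegral_mul _ (hw _) (hgw.pow_const _)] at h
  have e1 : ∫⁻ t in Ioc 0 r, ((fun t : ℝ => ENNReal.ofReal (t ^ (s - 1)))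
      * fun t => g t * ENNReal.ofReal (t ^ (1 - s))) t = ∫⁻ t in Ioc 0 r, g t := by
    refine setLIntegral_congr_fun measurableSet_Ioc fun t ht => ?_
    simp only [Pi.mul_apply]
    rw [mul_left_comm, ofReal_rpow_mul_ofReal_rpow ht.1]
    simp
  have e2 : ∫⁻ t in Ioc 0 r, ((fun t : ℝ => ENNReal.ofReal (t ^ (s - 1)))
      * fun t => (g t * ENNReal.ofReal (t ^ (1 - s))) ^ p) t
      = ∫⁻ t in Ioc 0 r, g t ^ p * ENNReal.ofReal (t ^ ((1 - s) * p + s - 1)) := by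
    refine setLIntegral_congr_fun measurableSet_Ioc fun t ht => ?_
    simp only [Pi.mul_apply]
    rw [ENNReal.mul_rpow_of_nonneg _ _ hp0.le,
      ENNReal.ofReal_rpow_of_pos (Real.rpow_pos_of_pos ht.1 _),
      ← Real.rpow_mul ht.1.le, mul_left_comm, ofReal_rpow_mul_ofReal_rpow ht.1]
    congr 3
    ring
  rwa [e1, e2] at h

/-- Hardy's inequality. -/
theorem lintegral_rpow_lintegral_Ioc_le {s p : ℝ} (hs : 0 < s) (hp : 1 ≤ p) {g : ℝ → ℝ≥0∞}
    (hg : Measurable g) :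
    ∫⁻ r in Ioi 0, ENNReal.ofReal (r ^ (-1 - s * p)) * (∫⁻ t in Ioc 0 r, g t) ^ p
      ≤ ENNReal.ofReal (s ^ (-p)) * ∫⁻ t in Ioi 0, g t ^ p * ENNReal.ofReal (t ^ ((1 - s) * p - 1)) := by
  have hp0 : 0 < p := by linarith
  set G : ℝ → ℝ≥0∞ := fun t => g t ^ p * ENNReal.ofReal (t ^ ((1 - s) * p + s - 1)) with hG
  have hGm : Measurable G := by fun_prop
  -- The weighted Jensen factor turns r^(-1-sp) into s^(1-p) r^(-1-s). After Tonelli, the integral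
  -- of r^(-1-s) over r ≥ t is t^(-s) / s, giving the constant s^(-p).
  have hpt : ∀ r ∈ Ioi (0 : ℝ),
      ENNReal.ofReal (r ^ (-1 - s * p)) * (∫⁻ t in Ioc 0 r, g t) ^ p
        ≤ ∫⁻ t in Ioi 0, ENNReal.ofReal (s ^ (1 - p)) *
          ((Ici t).indicator (fun r => ENNReal.ofReal (r ^ (-1 - s))) r * G t) := by
    intro r hr
    have hr : 0 < r := hr
    rw [lintegral_const_mul' _ _ ENNReal.ofReal_ne_top]
    have e1 : ∫⁻ t in Ioi 0, (Ici t).indicator (fun r => ENNReal.ofReal (r ^ (-1 - s))) r * G t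
        = ENNReal.ofReal (r ^ (-1 - s)) * ∫⁻ t in Ioc 0 r, G t := by
      rw [← lintegral_const_mul' _ _ ENNReal.ofReal_ne_top, ← Ioi_inter_Iic, inter_comm,
        ← setLIntegral_indicator measurableSet_Iic]
      · refine lintegral_congr fun t => ?_
        by_cases h : t ≤ r <;> simp [indicator, h]
    rw [e1]
    calc _ ≤ ENNReal.ofReal (r ^ (-1 - s * p)) * (ENNReal.ofReal (r ^ s / s) ^ (p - 1)
          * ∫⁻ t in Ioc 0 r, G t) := by
          gcongr
          exact rpow_lintegral_Ioc_le hs hp hg hr.le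
      _ = _ := by
          rw [← mul_assoc, ← mul_assoc]
          congr 1
          rw [ENNReal.ofReal_rpow_of_nonneg (by positivity) (by linarith),
            ← ENNReal.ofReal_mul (by positivity), ← ENNReal.ofReal_mul (by positivity)]
          congr 1
          rw [Real.div_rpow (by positivity) hs.le, ← Real.rpow_mul hr.le, ← mul_div_assoc,
            ← Real.rpow_add hr, div_eq_mul_inv, ← Real.rpow_neg hs.le, mul_comm]
          congr 2 <;> ring
  calc _ ≤ ∫⁻ r in Ioi 0, ∫⁻ t in Ioi 0, ENNReal.ofReal (s ^ (1 - p)) *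
          ((Ici t).indicator (fun r => ENNReal.ofReal (r ^ (-1 - s))) r * G t) :=
        setLIntegral_mono' measurableSet_Ioi hpt
    _ = ∫⁻ t in Ioi 0, ∫⁻ r in Ioi 0, ENNReal.ofReal (s ^ (1 - p)) *
          ((Ici t).indicator (fun r => ENNReal.ofReal (r ^ (-1 - s))) r * G t) := by
        refine lintegral_lintegral_swap (Measurable.aemeasurable ?_)
        refine Measurable.const_mul (Measurable.mul ?_ (by fun_prop)) _
        have : (fun z : ℝ × ℝ => (Ici z.2).indicator (fun r => ENNReal.ofReal (r ^ (-1 - s))) z.1)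
            = {z : ℝ × ℝ | z.2 ≤ z.1}.indicator fun z => ENNReal.ofReal (z.1 ^ (-1 - s)) := by
          ext z
          simp [indicator]
        exact this ▸ Measurable.indicator (by fun_prop)
          (measurableSet_le measurable_snd measurable_fst)
    _ = ∫⁻ t in Ioi 0, ENNReal.ofReal (s ^ (-p)) *
          (g t ^ p * ENNReal.ofReal (t ^ ((1 - s) * p - 1))) := by
        refine setLIntegral_congr_fun measurableSet_Ioi fun t ht => ?_
        have ht : 0 < t := ht
        rw [lintegral_const_mul' _ _ ENNReal.ofReal_ne_top, lintegral_mul_const _ (by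
          exact Measurable.indicator (by fun_prop) measurableSet_Ici),
          setLIntegral_indicator measurableSet_Ici, inter_eq_left.2 (Ici_subset_Ioi.2 ht),
          setLIntegral_congr Ioi_ae_eq_Ici.symm, lintegral_Ioi_rpow hs ht, hG]
        simp only
        rw [mul_left_comm (ENNReal.ofReal (t ^ (-s) / s)), ← ENNReal.ofReal_mul (by positivity),
          mul_left_comm, mul_left_comm (ENNReal.ofReal (s ^ (-p))),
          ← ENNReal.ofReal_mul (by positivity), ← ENNReal.ofReal_mul (by positivity)]
        congr 2
        rw [div_mul_eq_mul_div, ← Real.rpow_add ht, mul_div_assoc', mul_comm, mul_div_assoc,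
          Real.rpow_sub hs, Real.rpow_one, Real.rpow_neg hs.le, mul_comm]
        congr 1
        · field_simp
        · congr 1
          ring
    _ = _ := lintegral_const_mul' _ _ ENNReal.ofReal_ne_top

end OneDimensional

/-! ### Integral estimates on the half-space -/

section HalfSpaceAnalysis

theorem measurable_lintegral_Ioc {α : Type*} [MeasurableSpace α] {r : α → ℝ} (hr : Measurable r)
    {G : α → ℝ → ℝ≥0∞} (hG : Measurable (Function.uncurry G)) :
    Measurable fun a => ∫⁻ t in Ioc 0 (r a), G a t := by
  have h : (fun a => ∫⁻ t in Ioc 0 (r a), G a t)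
      = fun a => ∫⁻ t, {z : α × ℝ | 0 < z.2 ∧ z.2 ≤ r z.1}.indicator (Function.uncurry G) (a, t) := by
    ext a
    rw [← lintegral_indicator measurableSet_Ioc]
    rfl
  rw [h]
  refine Measurable.lintegral_prod_right' (hG.indicator ?_)
  exact (measurableSet_lt measurable_const measurable_snd).inter
    (measurableSet_le measurable_snd (hr.comp measurable_fst))

variable {E : Type*} [NormedAddCommGroup E] [NormedSpace ℝ E] [FiniteDimensional ℝ E]
  [MeasurableSpace E] [BorelSpace E] [SecondCountableTopology E] [Nontrivial E]
  (μ : Measure E) [μ.IsAddHaarMeasure]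

theorem lintegral_fun_norm_addHaar {f : ℝ → ℝ≥0∞} (hf : Measurable f) :
    ∫⁻ x, f ‖x‖ ∂μ = μ.toSphere univ
      * ∫⁻ r in Ioi (0 : ℝ), ENNReal.ofReal (r ^ (Module.finrank ℝ E - 1)) * f r := by
  have h1 : ∫⁻ x, f ‖x‖ ∂μ = ∫⁻ x : ({(0)}ᶜ : Set E), f ‖x.1‖ ∂(μ.comap (↑)) := by
    rw [lintegral_subtype_comap (measurableSet_singleton _).compl fun x => f ‖x‖,
      restrict_compl_singleton]
  have h2 : ∫⁻ x : ({(0)}ᶜ : Set E), f ‖x.1‖ ∂(μ.comap (↑))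
      = ∫⁻ x, f x.2.1 ∂μ.toSphere.prod (.volumeIoiPow (Module.finrank ℝ E - 1)) := by
    simpa using μ.measurePreserving_homeomorphUnitSphereProd.lintegral_comp_emb
      (Homeomorph.measurableEmbedding _) (f ∘ Subtype.val ∘ Prod.snd)
  have hf' : Measurable fun r : Ioi (0 : ℝ) => f r := hf.comp measurable_subtype_coe
  have h3 : Measurable fun x : Metric.sphere (0 : E) 1 × Ioi (0 : ℝ) => f x.2.1 :=
    hf'.comp measurable_snd
  rw [h1, h2, lintegral_prod _ h3.aemeasurable]
  simp only
  rw [lintegral_const, mul_comm,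
    Measure.volumeIoiPow, lintegral_withDensity_eq_lintegral_mul _ (by fun_prop) hf']
  congr 1
  exact lintegral_subtype_comap measurableSet_Ioi
    fun r => ENNReal.ofReal (r ^ (Module.finrank ℝ E - 1)) * f r

/-- The kernel `|h|⁻⁽ᵈ⁺ᵃ⁾`, where `d` is the dimension of the space. -/
noncomputable def kernel (a : ℝ) (h : E) : ℝ≥0∞ :=
  ENNReal.ofReal (‖h‖ ^ (-((Module.finrank ℝ E : ℝ) + a)))

@[fun_prop]
theorem measurable_kernel (a : ℝ) : Measurable (kernel a : E → ℝ≥0∞) := by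
  unfold kernel
  fun_prop

/-- Polar coordinates: r^(d-1) · r^(-(d+a)) = r^(-1-a), where d ≥ 1 is what `Nontrivial E` provides.
-/
theorem lintegral_kernel_mul {a : ℝ} {f : ℝ → ℝ≥0∞} (hf : Measurable f) :
    ∫⁻ h, kernel a h * f ‖h‖ ∂μ = μ.toSphere univ
      * ∫⁻ r in Ioi (0 : ℝ), ENNReal.ofReal (r ^ (-1 - a)) * f r := by
  refine (lintegral_fun_norm_addHaar μ (f := fun r : ℝ =>
    ENNReal.ofReal (r ^ (-((Module.finrank ℝ E : ℝ) + a))) * f r) (by fun_prop)).trans ?_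
  congr 1
  refine setLIntegral_congr_fun measurableSet_Ioi fun r hr => ?_
  have hr : 0 < r := hr
  rw [← mul_assoc, ← Real.rpow_natCast, ofReal_rpow_mul_ofReal_rpow hr]
  congr 3
  rw [Nat.cast_sub Module.finrank_pos]
  push_cast
  ring

theorem lintegral_kernel_indicator {a T : ℝ} (ha : 0 < a) (hT : 0 < T) :
    ∫⁻ h, kernel a h * (Ioi T).indicator 1 ‖h‖ ∂μ
      = μ.toSphere univ * ENNReal.ofReal (T ^ (-a) / a) := by
  rw [lintegral_kernel_mul μ (Measurable.indicator (by fun_prop) measurableSet_Ioi),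
    ← lintegral_Ioi_rpow ha hT]
  congr 1
  have : ∀ r : ℝ, ENNReal.ofReal (r ^ (-1 - a)) * (Ioi T).indicator 1 r
      = (Ioi T).indicator (fun r => ENNReal.ofReal (r ^ (-1 - a))) r := fun r => by
    by_cases h : r ∈ Ioi T <;> simp [h]
  simp only [this]
  rw [setLIntegral_indicator measurableSet_Ioi, inter_eq_left.2 (Ioi_subset_Ioi hT.le)]

/-- The weighted energy `∫∫ f(x, t)ᵖ t⁽¹⁻ˢ⁾ᵖ⁻¹ dt dx`. -/
noncomputable def energy (s p : ℝ) (f : E → ℝ → ℝ≥0∞) : ℝ≥0∞ :=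
  ∫⁻ x, (∫⁻ t in Ioi (0 : ℝ), f x t ^ p * ENNReal.ofReal (t ^ ((1 - s) * p - 1))) ∂μ

/-- For fixed `x` the integrand is radial in `h`, and polar coordinates reduce the claim to Hardy's
inequality in r = ‖h‖. -/
theorem lintegral_vertical_le {s p : ℝ} (hs : 0 < s) (hp : 1 ≤ p) {f : E → ℝ → ℝ≥0∞}
    (hf : Measurable (Function.uncurry f)) :
    ∫⁻ x, ∫⁻ h, kernel (s * p) h * (∫⁻ t in Ioc 0 ‖h‖, f x t) ^ p ∂μ ∂μ
      ≤ μ.toSphere univ * ENNReal.ofReal (s ^ (-p)) * energy μ s p f := by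
  rw [energy, ← lintegral_const_mul']
  · refine lintegral_mono fun x => ?_
    have hx : Measurable (f x) := hf.comp measurable_prodMk_left
    rw [lintegral_kernel_mul μ (f := fun r => (∫⁻ t in Ioc 0 r, f x t) ^ p)
      ((measurable_lintegral_Ioc (G := fun (_ : ℝ) t => f x t) measurable_id
        (hx.comp measurable_snd)).pow_const _), mul_assoc]
    gcongr
    exact lintegral_rpow_lintegral_Ioc_le hs hp hx
  · exact ENNReal.mul_ne_top (measure_ne_top _ _) ENNReal.ofReal_ne_top

theorem lintegral_translate {g : E → E → ℝ≥0∞} (hg : Measurable (Function.uncurry g)) :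
    ∫⁻ x, ∫⁻ h, g (x + h) h ∂μ ∂μ = ∫⁻ x, ∫⁻ h, g x h ∂μ ∂μ := by
  rw [lintegral_lintegral_swap (f := fun x h => g (x + h) h)
    (hg.comp (by fun_prop : Measurable fun z : E × E => (z.1 + z.2, z.2))).aemeasurable,
    lintegral_lintegral_swap hg.aemeasurable]
  exact lintegral_congr fun h => lintegral_add_right_eq_self (fun x => g x h) h

theorem lintegral_vertical_translate_le {s p : ℝ} (hs : 0 < s) (hp : 1 ≤ p) {f : E → ℝ → ℝ≥0∞}
    (hf : Measurable (Function.uncurry f)) :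
    ∫⁻ x, ∫⁻ h, kernel (s * p) h * (∫⁻ t in Ioc 0 ‖h‖, f (x + h) t) ^ p ∂μ ∂μ
      ≤ μ.toSphere univ * ENNReal.ofReal (s ^ (-p)) * energy μ s p f := by
  refine le_of_eq_of_le ?_ (lintegral_vertical_le μ hs hp hf)
  refine lintegral_translate μ (g := fun x h =>
    kernel (s * p) h * (∫⁻ t in Ioc 0 ‖h‖, f x t) ^ p) ?_
  refine ((measurable_kernel _).comp measurable_snd).mul (Measurable.pow_const ?_ _)
  exact measurable_lintegral_Ioc (G := fun (z : E × E) t => f z.1 t) (by fun_prop)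
    (hf.comp (by fun_prop : Measurable fun z : (E × E) × ℝ => (z.1.1, z.2)))

/-- For fixed `h`, Jensen in `l` and translation invariance in `x` remove the shift l • h. Polar
coordinates in `h` then make ‖h‖ the height variable, with exponent -1 - sp + p = (1 - s)p - 1. -/
theorem lintegral_horizontal_le {s p : ℝ} (hp : 1 ≤ p) {f : E → ℝ → ℝ≥0∞}
    (hf : Measurable (Function.uncurry f)) :
    ∫⁻ x, ∫⁻ h, kernel (s * p) h
        * (ENNReal.ofReal ‖h‖ * ∫⁻ l in Ioc (0 : ℝ) 1, f (x + l • h) ‖h‖) ^ p ∂μ ∂μ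
      ≤ μ.toSphere univ * energy μ s p f := by
  have hp0 : 0 < p := by linarith
  set J : ℝ → ℝ≥0∞ := fun r => ∫⁻ x, f x r ^ p ∂μ with hJ
  have hJm : Measurable J :=
    Measurable.lintegral_prod_left' (f := fun z : E × ℝ => f z.1 z.2 ^ p) (hf.pow_const _)
  have hm : Measurable fun z : (E × E) × ℝ => f (z.1.1 + z.2 • z.1.2) ‖z.1.2‖ :=
    hf.comp (by fun_prop : Measurable fun z : (E × E) × ℝ => (z.1.1 + z.2 • z.1.2, ‖z.1.2‖))
  have hjoint : Measurable fun z : E × E => kernel (s * p) z.2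
        * (ENNReal.ofReal ‖z.2‖ * ∫⁻ l in Ioc (0 : ℝ) 1, f (z.1 + l • z.2) ‖z.2‖) ^ p := by
    refine ((measurable_kernel _).comp measurable_snd).mul (Measurable.pow_const
      (Measurable.mul (by fun_prop) ?_) _)
    exact hm.lintegral_prod_right'
  rw [lintegral_lintegral_swap hjoint.aemeasurable]
  calc _ ≤ ∫⁻ h, kernel (s * p) h * (ENNReal.ofReal ‖h‖ ^ p * J ‖h‖) ∂μ := by
        refine lintegral_mono fun h => ?_
        simp only
        have hmh : Measurable fun z : E × ℝ => f (z.1 + z.2 • h) ‖h‖ :=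
          hf.comp (by fun_prop : Measurable fun z : E × ℝ => (z.1 + z.2 • h, ‖h‖))
        have hmh' : Measurable fun x => ∫⁻ l in Ioc (0 : ℝ) 1, f (x + l • h) ‖h‖ :=
          hmh.lintegral_prod_right'
        rw [lintegral_const_mul _ ((hmh'.const_mul _).pow_const _)]
        gcongr
        simp only [ENNReal.mul_rpow_of_nonneg _ _ hp0.le]
        rw [lintegral_const_mul _ (hmh'.pow_const _)]
        gcongr
        calc ∫⁻ x, (∫⁻ l in Ioc (0 : ℝ) 1, f (x + l • h) ‖h‖) ^ p ∂μ
            ≤ ∫⁻ x, (∫⁻ l in Ioc (0 : ℝ) 1, f (x + l • h) ‖h‖ ^ p) ∂μ := by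
              refine lintegral_mono fun x => ?_
              have := rpow_lintegral_le (ν := volume.restrict (Ioc (0 : ℝ) 1)) hp
                (g := fun l => f (x + l • h) ‖h‖)
                (hmh.comp measurable_prodMk_left).aemeasurable
              simpa using this
          _ = ∫⁻ l in Ioc (0 : ℝ) 1, ∫⁻ x, f (x + l • h) ‖h‖ ^ p ∂μ :=
              lintegral_lintegral_swap (hmh.pow_const p).aemeasurable
          _ = ∫⁻ l in Ioc (0 : ℝ) 1, J ‖h‖ :=
              lintegral_congr fun l =>
                lintegral_add_right_eq_self (fun x => f x ‖h‖ ^ p) (l • h)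
          _ = J ‖h‖ := by simp
    _ = μ.toSphere univ * ∫⁻ r in Ioi (0 : ℝ), ENNReal.ofReal (r ^ (-1 - s * p))
          * (ENNReal.ofReal r ^ p * J r) :=
        lintegral_kernel_mul μ (f := fun r => ENNReal.ofReal r ^ p * J r) (by fun_prop)
    _ = μ.toSphere univ * ∫⁻ r in Ioi (0 : ℝ), ∫⁻ x,
          f x r ^ p * ENNReal.ofReal (r ^ ((1 - s) * p - 1)) ∂μ := by
        congr 1
        refine setLIntegral_congr_fun measurableSet_Ioi fun r hr => ?_
        have hr : 0 < r := hr
        have hfr : Measurable fun x => f x r := hf.comp measurable_prodMk_right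
        rw [lintegral_mul_const _ (hfr.pow_const p), ← mul_assoc,
          ENNReal.ofReal_rpow_of_pos hr, ofReal_rpow_mul_ofReal_rpow hr, mul_comm,
          show -1 - s * p + p = (1 - s) * p - 1 by ring]
    _ = _ := by
        rw [energy]
        congr 1
        refine (lintegral_lintegral_swap (Measurable.aemeasurable ?_)).symm
        exact (hf.pow_const p).mul (by fun_prop)

/-- The trace estimate at scale `T`. -/
theorem trace_le {s p : ℝ} (hs0 : 0 < s) (hs1 : s < 1) (hp : 1 ≤ p) {f g : E → ℝ → ℝ≥0∞}
    (hf : Measurable (Function.uncurry f)) (hg : Measurable (Function.uncurry g)) {b : E → ℝ≥0∞}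
    (hb : ∀ x, ∀ t > 0, b x ≤ g x t + ∫⁻ r in Ioc 0 t, f x r) {T : ℝ} (hT : 0 < T) :
    ∫⁻ x, b x ^ p ∂μ ≤ 2 ^ (p - 1) * (ENNReal.ofReal ((1 - s) * p * T ^ (-((1 - s) * p)))
      * energy μ s p g + ENNReal.ofReal (s ^ (1 - p) * T ^ (s * p)) * energy μ s p f) := by
  have hp0 : 0 < p := by linarith
  set q := (1 - s) * p with hq
  have hq0 : 0 < q := mul_pos (by linarith) hp0
  set w : ℝ → ℝ≥0∞ := fun t => ENNReal.ofReal (t ^ (q - 1)) with hw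
  have hwm : Measurable w := by fun_prop
  have hpt : ∀ x, b x ^ p ≤ 2 ^ (p - 1) * (ENNReal.ofReal (q * T ^ (-q))
      * (∫⁻ t in Ioi 0, g x t ^ p * w t)
      + ENNReal.ofReal (s ^ (1 - p) * T ^ (s * p)) * ∫⁻ t in Ioi 0, f x t ^ p * w t) := by
    intro x
    have hfx : Measurable (f x) := hf.comp measurable_prodMk_left
    have hgx : Measurable (g x) := hg.comp measurable_prodMk_left
    set B := ∫⁻ t in Ioi 0, f x t ^ p * w t with hB
    set A := ∫⁻ t in Ioi 0, g x t ^ p * w t with hA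
    -- Weighted Jensen followed by r^s ≤ t^s on (0, t], which trades the weight r^(q+s-1) for the
    -- energy weight r^(q-1).
    have hin : ∀ t ∈ Ioc 0 T, (∫⁻ r in Ioc 0 t, f x r) ^ p
        ≤ ENNReal.ofReal (s ^ (1 - p) * T ^ (s * p)) * B := by
      intro t ht
      have ht0 : 0 < t := ht.1
      have hsub : ∫⁻ r in Ioc 0 t, f x r ^ p * ENNReal.ofReal (r ^ (q + s - 1))
          ≤ ENNReal.ofReal (t ^ s) * B := by
        rw [hB, ← lintegral_const_mul' _ _ ENNReal.ofReal_ne_top]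
        refine (setLIntegral_mono' measurableSet_Ioc fun r hr => ?_).trans
          (lintegral_mono_set Ioc_subset_Ioi_self)
        rw [show q + s - 1 = s + (q - 1) by ring, ← ofReal_rpow_mul_ofReal_rpow hr.1,
          mul_left_comm]
        gcongr
        · exact hr.1.le
        · exact hr.2
      refine (rpow_lintegral_Ioc_le hs0 hp hfx ht0.le).trans ?_
      refine (mul_le_mul_right hsub _).trans ?_
      rw [← mul_assoc, ENNReal.ofReal_rpow_of_nonneg (by positivity) (by linarith),
        ← ENNReal.ofReal_mul (by positivity)]
      refine mul_le_mul_left (ENNReal.ofReal_le_ofReal ?_) _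
      rw [Real.div_rpow (by positivity) hs0.le, ← Real.rpow_mul ht0.le, div_mul_eq_mul_div,
        ← Real.rpow_add ht0, div_eq_mul_inv, ← Real.rpow_neg hs0.le, mul_comm,
        show -(p - 1) = 1 - p by ring, show s * (p - 1) + s = s * p by ring]
      gcongr
      exact ht.2
    -- The pointwise bound is averaged over heights t ≤ T with weight t^(q-1), of total mass T^q /
    -- q.
    have hint : ∫⁻ t in Ioc 0 T, b x ^ p * w t
        ≤ 2 ^ (p - 1) * (A + ENNReal.ofReal (s ^ (1 - p) * T ^ (s * p)) * B
          * ENNReal.ofReal (T ^ q / q)) := by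
      calc ∫⁻ t in Ioc 0 T, b x ^ p * w t
          ≤ ∫⁻ t in Ioc 0 T, 2 ^ (p - 1) * (g x t ^ p * w t
            + ENNReal.ofReal (s ^ (1 - p) * T ^ (s * p)) * B * w t) := by
            refine setLIntegral_mono' measurableSet_Ioc fun t ht => ?_
            rw [← add_mul, ← mul_assoc]
            gcongr
            calc b x ^ p ≤ (g x t + ∫⁻ r in Ioc 0 t, f x r) ^ p := by
                  gcongr
                  exact hb x t ht.1
              _ ≤ _ := ENNReal.rpow_add_le_mul_rpow_add_rpow _ _ hp
              _ ≤ _ := by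
                  gcongr
                  exact hin t ht
        _ = 2 ^ (p - 1) * ((∫⁻ t in Ioc 0 T, g x t ^ p * w t)
            + ENNReal.ofReal (s ^ (1 - p) * T ^ (s * p)) * B * ENNReal.ofReal (T ^ q / q)) := by
            rw [lintegral_const_mul _ (by fun_prop), lintegral_add_left (by fun_prop),
              lintegral_const_mul _ hwm, lintegral_Ioc_rpow hq0 hT.le]
        _ ≤ _ := by
            gcongr
            exact lintegral_mono_set Ioc_subset_Ioi_self
    rw [lintegral_const_mul _ hwm, lintegral_Ioc_rpow hq0 hT.le] at hint
    have hone : ENNReal.ofReal (T ^ q / q) * ENNReal.ofReal (q * T ^ (-q)) = 1 := by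
      rw [← ENNReal.ofReal_mul (by positivity), Real.rpow_neg hT.le]
      have : T ^ q ≠ 0 := (Real.rpow_pos_of_pos hT q).ne'
      rw [show T ^ q / q * (q * (T ^ q)⁻¹) = 1 by field_simp, ENNReal.ofReal_one]
    calc b x ^ p = b x ^ p * ENNReal.ofReal (T ^ q / q) * ENNReal.ofReal (q * T ^ (-q)) := by
          rw [mul_assoc, hone, mul_one]
      _ ≤ 2 ^ (p - 1) * (A + ENNReal.ofReal (s ^ (1 - p) * T ^ (s * p)) * B
          * ENNReal.ofReal (T ^ q / q)) * ENNReal.ofReal (q * T ^ (-q)) := by gcongr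
      _ = _ := by
          rw [mul_assoc, add_mul, mul_assoc _ (ENNReal.ofReal (T ^ q / q)), hone, mul_one,
            mul_comm A]
  refine (lintegral_mono hpt).trans_eq ?_
  have hgm : Measurable fun x => ∫⁻ t in Ioi 0, g x t ^ p * w t :=
    Measurable.lintegral_prod_right' (f := fun z : E × ℝ => g z.1 z.2 ^ p * w z.2)
      ((hg.pow_const p).mul (by fun_prop))
  have hfm : Measurable fun x => ∫⁻ t in Ioi 0, f x t ^ p * w t :=
    Measurable.lintegral_prod_right' (f := fun z : E × ℝ => f z.1 z.2 ^ p * w z.2)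
      ((hf.pow_const p).mul (by fun_prop))
  rw [lintegral_const_mul _ (by fun_prop), lintegral_add_left (by fun_prop),
    lintegral_const_mul _ hgm, lintegral_const_mul _ hfm]
  rfl

end HalfSpaceAnalysis

/-- Optimisation of an inequality over the scale. -/
theorem le_of_forall_scale {s p q c : ℝ} (hs0 : 0 < s) (hs1 : s < 1) (hp : 0 < p)
    (hq : q = (1 - s) * p) (hc : 0 ≤ c) {K X A B : ℝ≥0∞} (hA : A ≠ ∞) (hB : B ≠ ∞) (hK : K ≠ ∞)
    (h : ∀ T : ℝ, 0 < T → X ≤ K * (ENNReal.ofReal (q * T ^ (-q)) * A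
      + ENNReal.ofReal (c * T ^ (s * p)) * B)) :
    X ≤ K * ENNReal.ofReal (q + c) * B ^ (1 - s) * A ^ s := by
  have hq0 : 0 < q := hq ▸ mul_pos (by linarith) hp
  -- Adding `ε` keeps the quotient positive and finite. The scale T = (a / b)^(1/p) makes T^(-q) a
  -- and T^(sp) b both equal to b^(1-s) a^s.
  have key : ∀ ε : ℝ≥0, 0 < ε → X ≤ K * ENNReal.ofReal (q + c) * ((B + ε) ^ (1 - s) * (A + ε) ^ s) := by
    intro ε hε
    set a : ℝ := A.toReal + ε with ha
    set b : ℝ := B.toReal + ε with hb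
    have hε' : (0 : ℝ) < ε := hε
    have ha0 : 0 < a := by positivity
    have hb0 : 0 < b := by positivity
    have hAa : A + ε = ENNReal.ofReal a := by
      rw [ha, ENNReal.ofReal_add ENNReal.toReal_nonneg (NNReal.coe_nonneg ε), ENNReal.ofReal_toReal hA,
        ENNReal.ofReal_coe_nnreal]
    have hBb : B + ε = ENNReal.ofReal b := by
      rw [hb, ENNReal.ofReal_add ENNReal.toReal_nonneg (NNReal.coe_nonneg ε), ENNReal.ofReal_toReal hB,
        ENNReal.ofReal_coe_nnreal]
    have e1 : ((a / b) ^ (1 / p)) ^ (-q) * a = b ^ (1 - s) * a ^ s := by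
      rw [← Real.rpow_mul (by positivity), hq, show 1 / p * -((1 - s) * p) = -(1 - s) by field_simp,
        Real.rpow_neg (by positivity), Real.div_rpow ha0.le hb0.le, inv_div, div_mul_eq_mul_div,
        mul_div_assoc]
      congr 1
      rw [div_eq_iff (by positivity), ← Real.rpow_add ha0]
      simp
    have e2 : ((a / b) ^ (1 / p)) ^ (s * p) * b = b ^ (1 - s) * a ^ s := by
      rw [← Real.rpow_mul (by positivity), show 1 / p * (s * p) = s by field_simp,
        Real.div_rpow ha0.le hb0.le, div_mul_eq_mul_div, div_eq_iff (by positivity), mul_right_comm,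
        ← Real.rpow_add hb0]
      simp [mul_comm]
    refine (h ((a / b) ^ (1 / p)) (by positivity)).trans ?_
    rw [mul_assoc]
    gcongr
    calc _ ≤ ENNReal.ofReal (q * ((a / b) ^ (1 / p)) ^ (-q)) * ENNReal.ofReal a
          + ENNReal.ofReal (c * ((a / b) ^ (1 / p)) ^ (s * p)) * ENNReal.ofReal b := by
          rw [← hAa, ← hBb]
          gcongr <;> exact le_self_add
      _ = ENNReal.ofReal (q + c) * ENNReal.ofReal (b ^ (1 - s) * a ^ s) := by
          rw [← ENNReal.ofReal_mul (by positivity), ← ENNReal.ofReal_mul (by positivity),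
            ← ENNReal.ofReal_mul (by positivity), ← ENNReal.ofReal_add (by positivity)
              (by positivity), mul_assoc, e1, mul_assoc, e2, add_mul]
      _ = _ := by
          rw [hAa, hBb, ENNReal.ofReal_rpow_of_pos ha0, ENNReal.ofReal_rpow_of_pos hb0,
            ENNReal.ofReal_mul (p := b ^ (1 - s)) (by positivity)]
  have hlim : Tendsto (fun ε : ℝ≥0 => K * ENNReal.ofReal (q + c)
      * ((B + ε) ^ (1 - s) * (A + ε) ^ s)) (𝓝[>] 0)
      (𝓝 (K * ENNReal.ofReal (q + c) * (B ^ (1 - s) * A ^ s))) := by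
    refine ENNReal.Tendsto.const_mul ?_ (Or.inr (ENNReal.mul_ne_top hK ENNReal.ofReal_ne_top))
    have hadd : ∀ A : ℝ≥0∞, Tendsto (fun ε : ℝ≥0 => A + ε) (𝓝[>] 0) (𝓝 A) := fun A => by
      have : Continuous fun ε : ℝ≥0 => A + ε := by fun_prop
      simpa using (this.tendsto 0).mono_left nhdsWithin_le_nhds
    refine ENNReal.Tendsto.mul (((ENNReal.continuous_rpow_const).tendsto _).comp (hadd B))
      (Or.inr (ENNReal.rpow_ne_top_of_nonneg hs0.le hA))
      (((ENNReal.continuous_rpow_const).tendsto _).comp (hadd A))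
      (Or.inr (ENNReal.rpow_ne_top_of_nonneg (by linarith) hB))
  rw [mul_assoc]
  exact ge_of_tendsto hlim (eventually_nhdsWithin_of_forall fun ε hε => key ε hε)

/-! ### The Gagliardo energy: short and long increments -/

section Gagliardo

variable {E : Type*} [NormedAddCommGroup E] [NormedSpace ℝ E] [FiniteDimensional ℝ E]
  [MeasurableSpace E] [BorelSpace E] [SecondCountableTopology E] [Nontrivial E]
  (μ : Measure E) [μ.IsAddHaarMeasure]

theorem lintegral_lintegral_add_right (f : E → E → ℝ≥0∞) {g : E → E → ℝ≥0∞}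
    (hg : Measurable (Function.uncurry g)) :
    ∫⁻ x, ∫⁻ h, (f x h + g x h) ∂μ ∂μ
      = (∫⁻ x, ∫⁻ h, f x h ∂μ ∂μ) + ∫⁻ x, ∫⁻ h, g x h ∂μ ∂μ := by
  have hgi : Measurable fun x => ∫⁻ h, g x h ∂μ := hg.lintegral_prod_right'
  rw [← lintegral_add_right _ hgi]
  exact lintegral_congr fun x => lintegral_add_right _ (hg.comp measurable_prodMk_left)

theorem energy_add_mul_le {s p : ℝ} (hp : 1 ≤ p) {f g : E → ℝ → ℝ≥0∞}
    (hf : Measurable (Function.uncurry f)) (c : ℝ≥0) :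
    energy μ s p (fun x t => f x t + c * g x t)
      ≤ 2 ^ (p - 1) * (energy μ s p f + (c : ℝ≥0∞) ^ p * energy μ s p g) := by
  have hp0 : 0 < p := by linarith
  have h2 : (2 : ℝ≥0∞) ^ (p - 1) ≠ ∞ := ENNReal.rpow_ne_top_of_nonneg (by linarith) (by simp)
  have hcp : (c : ℝ≥0∞) ^ p ≠ ∞ := ENNReal.rpow_ne_top_of_nonneg hp0.le (by simp)
  have hfm : Measurable fun x => ∫⁻ t in Ioi 0, f x t ^ p * ENNReal.ofReal (t ^ ((1 - s) * p - 1)) :=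
    Measurable.lintegral_prod_right' (f := fun z : E × ℝ => f z.1 z.2 ^ p *
      ENNReal.ofReal (z.2 ^ ((1 - s) * p - 1))) ((hf.pow_const p).mul (by fun_prop))
  unfold energy
  rw [← lintegral_const_mul' _ _ hcp, ← lintegral_add_left hfm, ← lintegral_const_mul' _ _ h2]
  refine lintegral_mono fun x => ?_
  have hfx : Measurable (f x) := hf.comp measurable_prodMk_left
  simp only
  rw [← lintegral_const_mul' _ _ hcp, ← lintegral_add_left (by fun_prop),
    ← lintegral_const_mul' _ _ h2]
  refine lintegral_mono fun t => ?_
  simp only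
  rw [← mul_assoc (_ ^ p), ← add_mul, ← mul_assoc, ← ENNReal.mul_rpow_of_nonneg _ _ hp0.le]
  gcongr
  exact ENNReal.rpow_add_le_mul_rpow_add_rpow _ _ hp

/-- The top and the two vertical sides of the rectangle, separated by two uses of (a + b)^p ≤
2^(p-1)(a^p + b^p). -/
theorem lintegral_kernel_mul_near_le {s p : ℝ} (hs : 0 < s) (hp : 1 ≤ p) {f : E → ℝ → ℝ≥0∞}
    (hf : Measurable (Function.uncurry f)) :
    ∫⁻ x, ∫⁻ h, kernel (s * p) h * (ENNReal.ofReal ‖h‖ * (∫⁻ l in Ioc (0 : ℝ) 1, f (x + l • h) ‖h‖)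
        + ((∫⁻ t in Ioc 0 ‖h‖, f x t) + ∫⁻ t in Ioc 0 ‖h‖, f (x + h) t)) ^ p ∂μ ∂μ
      ≤ 2 ^ (p - 1) * (1 + 2 ^ (p - 1) * (2 * ENNReal.ofReal (s ^ (-p)))) * μ.toSphere univ
        * energy μ s p f := by
  set D : ℝ≥0∞ := 2 ^ (p - 1) with hD
  have h2 : D ≠ ∞ := ENNReal.rpow_ne_top_of_nonneg (by linarith) (by simp)
  set k : E → ℝ≥0∞ := kernel (s * p) with hk
  set t1 : E → E → ℝ≥0∞ := fun x h =>
    k h * (ENNReal.ofReal ‖h‖ * (∫⁻ l in Ioc (0 : ℝ) 1, f (x + l • h) ‖h‖)) ^ p with ht1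
  set t2 : E → E → ℝ≥0∞ := fun x h => k h * (∫⁻ t in Ioc 0 ‖h‖, f x t) ^ p with ht2
  set t3 : E → E → ℝ≥0∞ := fun x h => k h * (∫⁻ t in Ioc 0 ‖h‖, f (x + h) t) ^ p with ht3
  have hkm : Measurable fun z : E × E => k z.2 := (measurable_kernel _).comp measurable_snd
  have hm1 : Measurable (Function.uncurry t1) := by
    refine hkm.mul (Measurable.pow_const (Measurable.mul (by fun_prop) ?_) _)
    have hm : Measurable fun z : (E × E) × ℝ => f (z.1.1 + z.2 • z.1.2) ‖z.1.2‖ :=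
      hf.comp (by fun_prop : Measurable fun z : (E × E) × ℝ => (z.1.1 + z.2 • z.1.2, ‖z.1.2‖))
    exact hm.lintegral_prod_right'
  have hm2 : Measurable (Function.uncurry t2) := by
    refine hkm.mul (Measurable.pow_const ?_ _)
    exact measurable_lintegral_Ioc (G := fun (z : E × E) t => f z.1 t) (by fun_prop)
      (hf.comp (by fun_prop : Measurable fun z : (E × E) × ℝ => (z.1.1, z.2)))
  have hpt : ∀ x h, k h * (ENNReal.ofReal ‖h‖ * (∫⁻ l in Ioc (0 : ℝ) 1, f (x + l • h) ‖h‖)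
        + ((∫⁻ t in Ioc 0 ‖h‖, f x t) + ∫⁻ t in Ioc 0 ‖h‖, f (x + h) t)) ^ p
      ≤ D * (t1 x h + D * (t2 x h + t3 x h)) := by
    intro x h
    simp only [ht1, ht2, ht3]
    rw [← mul_add, mul_left_comm D, ← mul_add, mul_left_comm]
    gcongr
    refine (ENNReal.rpow_add_le_mul_rpow_add_rpow _ _ hp).trans ?_
    gcongr
    exact ENNReal.rpow_add_le_mul_rpow_add_rpow _ _ hp
  have hx1 : ∀ x, Measurable (t1 x) := fun x => hm1.comp measurable_prodMk_left
  have hx2 : ∀ x, Measurable (t2 x) := fun x => hm2.comp measurable_prodMk_left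
  have hi1 : Measurable fun x => ∫⁻ h, t1 x h ∂μ := hm1.lintegral_prod_right'
  have hi2 : Measurable fun x => ∫⁻ h, t2 x h ∂μ := hm2.lintegral_prod_right'
  calc _ ≤ ∫⁻ x, ∫⁻ h, D * (t1 x h + D * (t2 x h + t3 x h)) ∂μ ∂μ :=
        lintegral_mono fun x => lintegral_mono fun h => hpt x h
    _ = D * ((∫⁻ x, ∫⁻ h, t1 x h ∂μ ∂μ)
          + D * ((∫⁻ x, ∫⁻ h, t2 x h ∂μ ∂μ) + ∫⁻ x, ∫⁻ h, t3 x h ∂μ ∂μ)) := by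
        simp only [lintegral_const_mul' _ _ h2, lintegral_add_left (hx1 _),
          lintegral_add_left (hx2 _)]
        rw [lintegral_add_left hi1, lintegral_const_mul' _ _ h2, lintegral_add_left hi2]
    _ ≤ D * (μ.toSphere univ * energy μ s p f
          + D * (μ.toSphere univ * ENNReal.ofReal (s ^ (-p)) * energy μ s p f
            + μ.toSphere univ * ENNReal.ofReal (s ^ (-p)) * energy μ s p f)) := by
        gcongr
        · exact lintegral_horizontal_le μ hp hf
        · exact lintegral_vertical_le μ hs hp hf
        · exact lintegral_vertical_translate_le μ hs hp hf
    _ = _ := by ring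

/-- Translation makes both terms contribute equally, each with the mass of the kernel outside the
ball of radius `T`. -/
theorem lintegral_kernel_mul_far_le {a T : ℝ} (ha : 0 < a) (hT : 0 < T) {b : E → ℝ≥0∞}
    (hb : Measurable b) :
    ∫⁻ x, ∫⁻ h, kernel a h * (Ioi T).indicator 1 ‖h‖ * (b x + b (x + h)) ∂μ ∂μ
      ≤ 2 * μ.toSphere univ * ENNReal.ofReal (T ^ (-a) / a) * ∫⁻ x, b x ∂μ := by
  set k : E → ℝ≥0∞ := fun h => kernel a h * (Ioi T).indicator 1 ‖h‖ with hk
  have hkm : Measurable k := (measurable_kernel a).mul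
    ((Measurable.indicator (by fun_prop) measurableSet_Ioi).comp measurable_norm)
  have hm : Measurable (Function.uncurry fun x h => k h * b x) :=
    (hkm.comp measurable_snd).mul (hb.comp measurable_fst)
  have h1 : ∫⁻ x, ∫⁻ h, k h * b x ∂μ ∂μ
      = μ.toSphere univ * ENNReal.ofReal (T ^ (-a) / a) * ∫⁻ x, b x ∂μ := by
    simp only [lintegral_mul_const _ hkm]
    rw [lintegral_const_mul _ hb, lintegral_kernel_indicator μ ha hT]
  have h2 : ∫⁻ x, ∫⁻ h, k h * b (x + h) ∂μ ∂μ = ∫⁻ x, ∫⁻ h, k h * b x ∂μ ∂μ :=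
    lintegral_translate μ (g := fun x h => k h * b x) hm
  simp only [mul_add]
  rw [show (∫⁻ x, ∫⁻ h, (k h * b x + k h * b (x + h)) ∂μ ∂μ)
    = (∫⁻ x, ∫⁻ h, k h * b x ∂μ ∂μ) + ∫⁻ x, ∫⁻ h, k h * b (x + h) ∂μ ∂μ by
      simp only [lintegral_add_left (hkm.mul_const _)]
      exact lintegral_add_left hm.lintegral_prod_right' _, h2, h1]
  exact le_of_eq (by ring)

/-- The Gagliardo energy of a function `ρ` of two variables is controlled by weighted energies on
the half-space. -/
theorem gagliardo_le {s p : ℝ} (hs0 : 0 < s) (hs1 : s < 1) (hp : 1 ≤ p) :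
    ∃ C : ℝ≥0, ∀ (f g : E → ℝ → ℝ≥0∞) (b : E → ℝ≥0∞) (ρ : E → E → ℝ≥0∞) (β : ℝ≥0),
      Measurable (Function.uncurry f) → Measurable (Function.uncurry g) → Measurable b →
      (∀ x, ∀ t > 0, b x ≤ g x t + ∫⁻ r in Ioc 0 t, f x r) →
      (∀ x h, ρ x h ≤ b x + b (x + h)) →
      (∀ x h, ρ x h ≤ ENNReal.ofReal ‖h‖ * (∫⁻ l in Ioc (0 : ℝ) 1, f (x + l • h) ‖h‖)
        + ∫⁻ t in Ioc 0 ‖h‖, (f x t + f (x + h) t + ENNReal.ofReal (β * ‖h‖) * g (x + h) t)) →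
      ∫⁻ x, ∫⁻ h, kernel (s * p) h * ρ x h ^ p ∂μ ∂μ
        ≤ C * (energy μ s p f + (β : ℝ≥0∞) ^ (p / 2) * energy μ s p g) := by
  have hp0 : 0 < p := by linarith
  set D : ℝ≥0∞ := 2 ^ (p - 1) with hD
  have h2 : D ≠ ∞ := ENNReal.rpow_ne_top_of_nonneg (by linarith) (by simp)
  set C₁ : ℝ≥0∞ := D * (1 + D * (2 * ENNReal.ofReal (s ^ (-p)))) * μ.toSphere univ * D with hC₁
  -- Product of the splitting constant, the tail of the kernel and the constant of the trace
  -- estimate, powers of `T` removed.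
  set C₂ : ℝ≥0∞ := D * (2 * μ.toSphere univ * ENNReal.ofReal (1 / (s * p)))
    * (D * ENNReal.ofReal ((1 - s) * p + s ^ (1 - p))) with hC₂
  have hC : C₁ + C₂ ≠ ∞ := by finiteness
  refine ⟨(C₁ + C₂).toNNReal, fun f g b ρ β hf hg hb hb1 hρ hρ1 => ?_⟩
  rw [ENNReal.coe_toNNReal hC]
  -- If β‖h‖² ≤ 1 then β‖h‖ ≤ √β, so `Θ` dominates all terms of the short-range bound, and (√β)^p is
  -- the required power of `β`.
  set c : ℝ≥0 := NNReal.sqrt β with hc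
  set Θ : E → ℝ → ℝ≥0∞ := fun x t => f x t + c * g x t with hΘ
  have hΘm : Measurable (Function.uncurry Θ) := hf.add (hg.const_mul _)
  have hcp : (c : ℝ≥0∞) ^ p = (β : ℝ≥0∞) ^ (p / 2) := by
    rw [← ENNReal.coe_rpow_of_nonneg _ hp0.le, ← ENNReal.coe_rpow_of_nonneg _ (by positivity), hc,
      NNReal.sqrt_eq_rpow, ← NNReal.rpow_mul]
    congr 2
    ring
  set W := energy μ s p f + (β : ℝ≥0∞) ^ (p / 2) * energy μ s p g with hW
  have hΘW : energy μ s p Θ ≤ D * W := by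
    rw [hW, ← hcp]
    exact energy_add_mul_le μ hp hf c
  set H : E → E → ℝ≥0∞ := fun x h =>
    ENNReal.ofReal ‖h‖ * (∫⁻ l in Ioc (0 : ℝ) 1, Θ (x + l • h) ‖h‖)
        + ((∫⁻ t in Ioc 0 ‖h‖, Θ x t) + ∫⁻ t in Ioc 0 ‖h‖, Θ (x + h) t) with hH
  have hnear : ∀ x h, β * ‖h‖ ^ 2 ≤ 1 → ρ x h ≤ H x h := by
    intro x h hh
    refine (hρ1 x h).trans ?_
    have hβ : ENNReal.ofReal (β * ‖h‖) ≤ c := by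
      rw [← ENNReal.ofReal_coe_nnreal]
      refine ENNReal.ofReal_le_ofReal ?_
      rw [hc, Real.coe_sqrt]
      have h3 : √(β : ℝ) ^ 2 = β := Real.sq_sqrt β.2
      have h4 : √(β : ℝ) * ‖h‖ ≤ 1 := by
        refine (sq_le_one_iff₀ (by positivity)).1 ?_
        rwa [mul_pow, h3]
      calc (β : ℝ) * ‖h‖ = √(β : ℝ) * (√(β : ℝ) * ‖h‖) := by rw [← mul_assoc, ← sq, h3]
        _ ≤ √(β : ℝ) * 1 := by gcongr
        _ = √(β : ℝ) := mul_one _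
    have hΘx : Measurable (Θ x) := hΘm.comp measurable_prodMk_left
    simp only [hH]
    rw [← lintegral_add_left hΘx]
    refine add_le_add ?_ (lintegral_mono fun t => ?_)
    · gcongr with l
      exact le_self_add
    · simp only [hΘ]
      rw [add_assoc]
      exact add_le_add le_self_add (by gcongr)
  have hnear_int : ∫⁻ x, ∫⁻ h, kernel (s * p) h * H x h ^ p ∂μ ∂μ ≤ C₁ * W := by
    refine (lintegral_kernel_mul_near_le μ hs0 hp hΘm).trans ?_
    rw [hC₁, mul_assoc _ D W]
    gcongr
  -- Without curvature every increment is short; the threshold β^(-1/2) is meaningful only for β >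
  -- 0.
  rcases eq_or_ne β 0 with hβ0 | hβ0
  · calc _ ≤ ∫⁻ x, ∫⁻ h, kernel (s * p) h * H x h ^ p ∂μ ∂μ := by
          gcongr with x h
          exact hnear x h (by simp [hβ0])
      _ ≤ C₁ * W := hnear_int
      _ ≤ _ := by
          gcongr
          exact le_self_add
  · have hβpos : (0 : ℝ) < β := by exact_mod_cast pos_iff_ne_zero.2 hβ0
    set T : ℝ := (β : ℝ) ^ (-(1 / 2) : ℝ) with hT
    have hT0 : 0 < T := Real.rpow_pos_of_pos hβpos _
    have hT2 : β * T ^ 2 = 1 := by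
      rw [hT, ← Real.rpow_natCast, ← Real.rpow_mul hβpos.le]
      norm_num
      rw [Real.rpow_neg_one, mul_inv_cancel₀ hβpos.ne']
    set k : E → ℝ≥0∞ := kernel (s * p) with hk
    have hpt : ∀ x h, k h * ρ x h ^ p ≤ k h * H x h ^ p
        + D * (k h * (Ioi T).indicator 1 ‖h‖ * (b x ^ p + b (x + h) ^ p)) := by
      intro x h
      by_cases hh : ‖h‖ ≤ T
      · refine le_trans ?_ le_self_add
        gcongr
        refine hnear x h ?_
        rw [← hT2]
        gcongr
      · refine le_trans ?_ le_add_self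
        rw [indicator_of_mem (by simpa using hh), Pi.one_apply, mul_one, mul_left_comm]
        gcongr
        refine (ENNReal.rpow_le_rpow (hρ x h) hp0.le).trans ?_
        exact ENNReal.rpow_add_le_mul_rpow_add_rpow _ _ hp
    have hbp : Measurable fun x => b x ^ p := hb.pow_const p
    have hfar : ∫⁻ x, ∫⁻ h, D * (k h * (Ioi T).indicator 1 ‖h‖ * (b x ^ p + b (x + h) ^ p)) ∂μ ∂μ
        ≤ C₂ * W := by
      simp only [lintegral_const_mul' _ _ h2]
      have h3 := lintegral_kernel_mul_far_le μ (mul_pos hs0 hp0) hT0 hbp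
      have h4 := trace_le μ hs0 hs1 hp hf hg hb1 hT0
      have h5 : ENNReal.ofReal (T ^ (-(s * p)) / (s * p)) * (D *
          (ENNReal.ofReal ((1 - s) * p * T ^ (-((1 - s) * p))) * energy μ s p g
          + ENNReal.ofReal (s ^ (1 - p) * T ^ (s * p)) * energy μ s p f))
          ≤ ENNReal.ofReal (1 / (s * p)) * (D * ENNReal.ofReal ((1 - s) * p + s ^ (1 - p))) * W := by
        have hq0 : 0 < (1 - s) * p := mul_pos (by linarith) hp0
        have e1 : T ^ (-(s * p)) * T ^ (s * p) = 1 := by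
          rw [← Real.rpow_add hT0]
          simp
        -- The powers of `T` from the tail and from the trace estimate combine to T^(-p) on the
        -- energy of `g`, and cancel (`e1`) on that of `f`.
        have e2 : T ^ (-(s * p)) * T ^ (-((1 - s) * p)) = (β : ℝ) ^ (p / 2) := by
          rw [← Real.rpow_add hT0, hT, ← Real.rpow_mul hβpos.le]
          congr 1
          ring
        have hβp : (β : ℝ≥0∞) ^ (p / 2) = ENNReal.ofReal ((β : ℝ) ^ (p / 2)) := by
          rw [← ENNReal.ofReal_rpow_of_pos hβpos, ENNReal.ofReal_coe_nnreal]
        rw [show T ^ (-(s * p)) / (s * p) = 1 / (s * p) * T ^ (-(s * p)) by ring,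
          ENNReal.ofReal_mul (by positivity), mul_assoc (ENNReal.ofReal (1 / (s * p))),
          mul_assoc (ENNReal.ofReal (1 / (s * p)))]
        gcongr ENNReal.ofReal (1 / (s * p)) * ?_
        rw [mul_left_comm, mul_assoc D]
        gcongr D * ?_
        rw [mul_add, ← mul_assoc, ← mul_assoc, ← ENNReal.ofReal_mul (by positivity),
          ← ENNReal.ofReal_mul (by positivity), mul_left_comm _ (s ^ (1 - p)), e1,
          mul_left_comm _ ((1 - s) * p), e2, mul_one, hW, hβp, mul_add, add_comm,
          ENNReal.ofReal_mul hq0.le, mul_assoc]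
        gcongr
        · linarith
        · have := Real.rpow_pos_of_pos hs0 (1 - p)
          linarith
      calc _ ≤ D * (2 * μ.toSphere univ * ENNReal.ofReal (T ^ (-(s * p)) / (s * p))
            * (D * (ENNReal.ofReal ((1 - s) * p * T ^ (-((1 - s) * p))) * energy μ s p g
          + ENNReal.ofReal (s ^ (1 - p) * T ^ (s * p)) * energy μ s p f))) := by
            gcongr
            exact h3.trans (by gcongr)
        _ ≤ D * (2 * μ.toSphere univ * (ENNReal.ofReal (1 / (s * p))
            * (D * ENNReal.ofReal ((1 - s) * p + s ^ (1 - p))) * W)) := by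
            rw [mul_assoc (2 * _)]
            gcongr
        _ = C₂ * W := by
            rw [hC₂]
            ring
    have hkm : Measurable k := measurable_kernel _
    set G : E → E → ℝ≥0∞ := fun x h =>
      D * (k h * (Ioi T).indicator 1 ‖h‖ * (b x ^ p + b (x + h) ^ p)) with hG
    have hGm : Measurable (Function.uncurry G) := by
      have hi : Measurable ((Ioi T).indicator (1 : ℝ → ℝ≥0∞)) :=
        Measurable.indicator measurable_one measurableSet_Ioi
      refine Measurable.const_mul (Measurable.mul (Measurable.mul ?_ ?_) ?_) _
      · exact hkm.comp measurable_snd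
      · exact hi.comp (measurable_norm.comp measurable_snd)
      · exact (hbp.comp measurable_fst).add (hbp.comp measurable_add)
    calc _ ≤ ∫⁻ x, ∫⁻ h, (k h * H x h ^ p + G x h) ∂μ ∂μ :=
          lintegral_mono fun x => lintegral_mono fun h => hpt x h
      _ = (∫⁻ x, ∫⁻ h, k h * H x h ^ p ∂μ ∂μ) + ∫⁻ x, ∫⁻ h, G x h ∂μ ∂μ :=
          lintegral_lintegral_add_right μ (fun x h => k h * H x h ^ p) hGm
      _ ≤ C₁ * W + C₂ * W := add_le_add hnear_int hfar
      _ = _ := (add_mul _ _ _).symm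

end Gagliardo

/-! ### Coordinates on the half-space and the Hilbert–Schmidt norm -/

section Coordinates

/-- The inner unit normal vector to the boundary of the half-space. -/
noncomputable def normalVec (n : ℕ) : EuclideanSpace ℝ (Fin (n + 1)) :=
  EuclideanSpace.single (Fin.last n) 1

@[simp]
theorem boundaryEmb_last {n : ℕ} (x : EuclideanSpace ℝ (Fin n)) :
    boundaryEmb n x (Fin.last n) = 0 := by
  simp [boundaryEmb]

@[simp]
theorem boundaryEmb_castSucc {n : ℕ} (x : EuclideanSpace ℝ (Fin n)) (i : Fin n) :
    boundaryEmb n x i.castSucc = x i := by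
  simp [boundaryEmb]

@[simp]
theorem normalVec_last (n : ℕ) : normalVec n (Fin.last n) = 1 := by simp [normalVec]

@[simp]
theorem normalVec_castSucc {n : ℕ} (i : Fin n) : normalVec n i.castSucc = 0 := by
  simp [normalVec]

@[simp]
theorem norm_normalVec (n : ℕ) : ‖normalVec n‖ = 1 := by simp [normalVec]

theorem norm_boundaryEmb {n : ℕ} (x : EuclideanSpace ℝ (Fin n)) : ‖boundaryEmb n x‖ = ‖x‖ := by
  rw [EuclideanSpace.norm_eq, EuclideanSpace.norm_eq, Fin.sum_univ_castSucc]
  simp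

theorem measurePreserving_boundaryEmb_add (n : ℕ) :
    MeasurePreserving (fun z : EuclideanSpace ℝ (Fin n) × ℝ => boundaryEmb n z.1 + z.2 • normalVec n)
      (volume.prod volume) volume := by
  have h2 : MeasurePreserving (Prod.map (MeasurableEquiv.toLp 2 (Fin n → ℝ)).symm (id : ℝ → ℝ))
      (volume.prod volume) (volume.prod volume) :=
    (EuclideanSpace.volume_preserving_symm_measurableEquiv_toLp (Fin n)).prod
      (MeasurePreserving.id volume)
  have h3 : MeasurePreserving (Prod.swap : (Fin n → ℝ) × ℝ → ℝ × (Fin n → ℝ))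
      (volume.prod volume) (volume.prod volume) := Measure.measurePreserving_swap
  have h4 := (volume_preserving_piFinSuccAbove (fun _ : Fin (n + 1) => ℝ) (Fin.last n)).symm
  have h5 := (EuclideanSpace.volume_preserving_symm_measurableEquiv_toLp (Fin (n + 1))).symm
  have h := h5.comp (h4.comp (h3.comp h2))
  have hfun : (fun z : EuclideanSpace ℝ (Fin n) × ℝ => boundaryEmb n z.1 + z.2 • normalVec n)
      = (MeasurableEquiv.toLp 2 (Fin (n + 1) → ℝ)).symm.symm
        ∘ (MeasurableEquiv.piFinSuccAbove (fun _ => ℝ) (Fin.last n)).symm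
        ∘ Prod.swap ∘ Prod.map (MeasurableEquiv.toLp 2 (Fin n → ℝ)).symm id := by
    funext z
    ext i
    refine Fin.lastCases ?_ (fun j => ?_) i
    · simp [MeasurableEquiv.piFinSuccAbove, Fin.insertNthEquiv]
    · simp [MeasurableEquiv.piFinSuccAbove, Fin.insertNthEquiv]
  rw [hfun]
  exact h

theorem lintegral_openHalfSpace {n : ℕ} {f : EuclideanSpace ℝ (Fin (n + 1)) → ℝ≥0∞}
    (hf : Measurable f) :
    ∫⁻ z in openHalfSpace n, f z
      = ∫⁻ x, ∫⁻ t in Ioi (0 : ℝ), f (boundaryEmb n x + t • normalVec n) := by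
  have hm : MeasurableSet (openHalfSpace n) :=
    (isOpen_lt continuous_const (by fun_prop)).measurableSet
  have hmp := measurePreserving_boundaryEmb_add n
  have hfm : Measurable fun z : EuclideanSpace ℝ (Fin n) × ℝ =>
      (openHalfSpace n).indicator f (boundaryEmb n z.1 + z.2 • normalVec n) :=
    (hf.indicator hm).comp hmp.measurable
  rw [← lintegral_indicator hm, ← hmp.lintegral_comp (hf.indicator hm),
    lintegral_prod _ hfm.aemeasurable]
  refine lintegral_congr fun x => ?_
  rw [← lintegral_indicator measurableSet_Ioi]
  refine lintegral_congr fun t => ?_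
  by_cases ht : 0 < t <;> simp [indicator, openHalfSpace, ht]

theorem uniqueDiffOn_closedHalfSpace (n : ℕ) : UniqueDiffOn ℝ (closedHalfSpace n) := by
  refine uniqueDiffOn_convex ?_ ⟨normalVec n, ?_⟩
  · exact convex_halfSpace_ge (f := fun z : EuclideanSpace ℝ (Fin (n + 1)) => z (Fin.last n))
      ⟨fun _ _ => rfl, fun _ _ => rfl⟩ 0
  · have : IsOpen (openHalfSpace n) := isOpen_lt continuous_const (by fun_prop)
    have hsub : openHalfSpace n ⊆ closedHalfSpace n := fun z hz => (show 0 < z _ from hz).le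
    exact interior_maximal hsub this (by simp [openHalfSpace])

/-- The nearest point projection onto the closed half-space. -/
noncomputable def halfSpaceProj (n : ℕ) (z : EuclideanSpace ℝ (Fin (n + 1))) :
    EuclideanSpace ℝ (Fin (n + 1)) :=
  z + (max (z (Fin.last n)) 0 - z (Fin.last n)) • normalVec n

/-- Composition with the projection extends functions continuous on the closed half-space to
continuous functions everywhere, which settles measurability. -/
theorem continuous_halfSpaceProj (n : ℕ) : Continuous (halfSpaceProj n) := by
  unfold halfSpaceProj
  fun_prop

theorem halfSpaceProj_mem {n : ℕ} (z : EuclideanSpace ℝ (Fin (n + 1))) :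
    halfSpaceProj n z ∈ closedHalfSpace n := by
  simp [closedHalfSpace, halfSpaceProj]

theorem halfSpaceProj_eq_self {n : ℕ} {z : EuclideanSpace ℝ (Fin (n + 1))}
    (hz : z ∈ closedHalfSpace n) : halfSpaceProj n z = z := by
  have hz : 0 ≤ z (Fin.last n) := hz
  simp [halfSpaceProj, max_eq_left hz]

variable {F : Type*} [NormedAddCommGroup F] [InnerProductSpace ℝ F]

theorem continuous_hsNorm {m : ℕ} :
    Continuous (hsNorm : (EuclideanSpace ℝ (Fin m) →L[ℝ] F) → ℝ) := by
  unfold hsNorm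
  fun_prop

/-- Cauchy–Schwarz on the coordinates of `v`. -/
theorem norm_apply_le_hsNorm {m : ℕ} (T : EuclideanSpace ℝ (Fin m) →L[ℝ] F)
    (v : EuclideanSpace ℝ (Fin m)) : ‖T v‖ ≤ hsNorm T * ‖v‖ := by
  have hv : T v = ∑ i, v i • T (EuclideanSpace.single i 1) := by
    conv_lhs => rw [← (EuclideanSpace.basisFun (Fin m) ℝ).sum_repr v]
    simp
  rw [hv]
  calc ‖∑ i, v i • T (EuclideanSpace.single i 1)‖
      ≤ ∑ i, ‖T (EuclideanSpace.single i 1)‖ * ‖v i‖ := by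
        refine (norm_sum_le _ _).trans_eq (Finset.sum_congr rfl fun i _ => ?_)
        rw [norm_smul, mul_comm]
    _ ≤ √(∑ i, ‖T (EuclideanSpace.single i 1)‖ ^ 2) * √(∑ i, ‖v i‖ ^ 2) :=
        Real.sum_mul_le_sqrt_mul_sqrt _ _ _
    _ = hsNorm T * ‖v‖ := by rw [hsNorm, EuclideanSpace.norm_eq v]

end Coordinates

/-! ### Translation of the norms of the statement into scalar energies -/

section Trace

theorem ofReal_intervalIntegral_le {a b : ℝ} (hab : a ≤ b) {M : ℝ → ℝ} {f : ℝ → ℝ≥0∞}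
    (h : ∀ t ∈ Ioc a b, ‖M t‖ₑ ≤ f t) :
    ENNReal.ofReal (∫ t in a..b, M t) ≤ ∫⁻ t in Ioc a b, f t := by
  rw [intervalIntegral.integral_of_le hab]
  calc ENNReal.ofReal (∫ t in Ioc a b, M t) ≤ ‖∫ t in Ioc a b, M t‖ₑ := Real.ofReal_le_enorm _
    _ ≤ ∫⁻ t in Ioc a b, ‖M t‖ₑ := enorm_integral_le_lintegral_enorm _
    _ ≤ _ := setLIntegral_mono' measurableSet_Ioc h

theorem isParallelTransport_segment_iff {V F : Type*} [NormedAddCommGroup V] [NormedSpace ℝ V]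
    [NormedAddCommGroup F] [InnerProductSpace ℝ F] {A : V → V →L[ℝ] (F →L[ℝ] F)} {x y : V}
    {P : ℝ → F →L[ℝ] F} :
    IsParallelTransport A (fun t => (1 - t) • x + t • y) P
      ↔ SolvesTransport (fun t => A (x + t • (y - x)) (y - x)) P := by
  have h1 : ∀ t ∈ Icc (0 : ℝ) 1,
      derivWithin (fun t : ℝ => (1 - t) • x + t • y) (Icc 0 1) t = y - x := fun t ht => by
    have hd : HasDerivWithinAt (fun t : ℝ => (1 - t) • x + t • y) (y - x) (Icc 0 1) t := by
      have := (((hasDerivWithinAt_id t (Icc (0 : ℝ) 1)).const_sub 1).smul_const x).fun_add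
        ((hasDerivWithinAt_id t (Icc (0 : ℝ) 1)).smul_const y)
      refine this.congr_deriv ?_
      module
    exact hd.derivWithin (uniqueDiffOn_Icc zero_lt_one t ht)
  have h2 : ∀ t : ℝ, (1 - t) • x + t • y = x + t • (y - x) := fun t => by module
  unfold IsParallelTransport SolvesTransport
  refine and_congr_left fun _ => forall₂_congr fun t ht => ?_
  simp only
  rw [h1 t ht, h2]

variable {n : ℕ} {F : Type*} [NormedAddCommGroup F] [InnerProductSpace ℝ F]
  {Γ : EuclideanSpace ℝ (Fin (n + 1)) → EuclideanSpace ℝ (Fin (n + 1)) →L[ℝ] (F →L[ℝ] F)}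
  {U : EuclideanSpace ℝ (Fin (n + 1)) → F}

theorem boundaryEmb_add_smul_mem (x : EuclideanSpace ℝ (Fin n)) {t : ℝ} (ht : 0 ≤ t) :
    boundaryEmb n x + t • normalVec n ∈ closedHalfSpace n := by
  simpa [closedHalfSpace] using ht

theorem boundaryEmb_mem (x : EuclideanSpace ℝ (Fin n)) : boundaryEmb n x ∈ closedHalfSpace n := by
  simp [closedHalfSpace]

/-- The parallel transport along a boundary segment solves the transport equation. -/
theorem exists_segmentTransport_eq [FiniteDimensional ℝ F]
    (hΓ : ContinuousOn Γ (closedHalfSpace n)) (x h : EuclideanSpace ℝ (Fin n)) :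
    ∃ R, SolvesTransport (fun l => Γ (boundaryEmb n x + l • boundaryEmb n h) (boundaryEmb n h)) R ∧
      segmentTransport (tangential Γ) x (x + h) = R 0 := by
  have := FiniteDimensional.complete ℝ F
  have hiff : ∀ P, IsParallelTransport (tangential Γ) (fun t => (1 - t) • x + t • (x + h)) P ↔
      SolvesTransport (fun l => Γ (boundaryEmb n x + l • boundaryEmb n h) (boundaryEmb n h)) P := by
    intro P
    rw [isParallelTransport_segment_iff]
    simp [tangential]
  have hex : ∃ P, IsParallelTransport (tangential Γ) (fun t => (1 - t) • x + t • (x + h)) P := by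
    simp only [hiff]
    refine exists_solvesTransport (ContinuousOn.clm_apply ?_ continuousOn_const)
    refine hΓ.comp (by fun_prop) fun l _ => ?_
    rw [← map_smul, ← map_add]
    exact boundaryEmb_mem _
  -- The chosen solution itself is the witness; the estimates hold for any solution, so it need not
  -- be identified further.
  refine ⟨parallelTransport (tangential Γ) (fun t => (1 - t) • x + t • (x + h)), ?_, rfl⟩
  rw [← hiff, parallelTransport, dif_pos hex]
  exact hex.choose_spec

theorem norm_le_norm_boundaryEmb_add (x : EuclideanSpace ℝ (Fin n)) (t : ℝ) :
    ‖x‖ ≤ ‖boundaryEmb n x + t • normalVec n‖ := by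
  rw [EuclideanSpace.norm_eq, EuclideanSpace.norm_eq, Fin.sum_univ_castSucc]
  refine Real.sqrt_le_sqrt ?_
  simp only [PiLp.add_apply, boundaryEmb_castSucc, PiLp.smul_apply, normalVec_castSucc, smul_zero,
    add_zero]
  exact le_add_of_nonneg_right (sq_nonneg _)

theorem abs_le_norm_boundaryEmb_add (x : EuclideanSpace ℝ (Fin n)) (t : ℝ) :
    |t| ≤ ‖boundaryEmb n x + t • normalVec n‖ := by
  have := PiLp.norm_apply_le (boundaryEmb n x + t • normalVec n) (Fin.last n)
  simpa using this

/-- The function is bounded with bounded support, and t^((1-s)p-1) is integrable at 0 because (1 -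
s)p > 0. -/
theorem energy_lt_top {s p : ℝ} (hs1 : s < 1) (hp : 1 ≤ p)
    {φ : EuclideanSpace ℝ (Fin (n + 1)) → ℝ} (hφ : ContinuousOn φ (closedHalfSpace n))
    {K : Set (EuclideanSpace ℝ (Fin (n + 1)))} (hK : IsCompact K) (hKΩ : K ⊆ closedHalfSpace n)
    (h0 : ∀ z ∈ closedHalfSpace n, z ∉ K → φ z = 0) :
    energy volume s p (fun (x : EuclideanSpace ℝ (Fin n)) t =>
      ENNReal.ofReal (φ (halfSpaceProj n (boundaryEmb n x + t • normalVec n)))) ≠ ∞ := by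
  have hp0 : 0 < p := by linarith
  have hq0 : 0 < (1 - s) * p := mul_pos (by linarith) hp0
  obtain ⟨M, hM⟩ := hK.exists_bound_of_continuousOn (hφ.mono hKΩ)
  obtain ⟨r, hr⟩ := hK.isBounded.subset_closedBall 0
  set B := Metric.closedBall (0 : EuclideanSpace ℝ (Fin n)) r
  set r' := max r 0
  have hpt : ∀ x : EuclideanSpace ℝ (Fin n), ∀ t > 0,
      ENNReal.ofReal (φ (halfSpaceProj n (boundaryEmb n x + t • normalVec n))) ^ p
        ≤ B.indicator (fun _ => ENNReal.ofReal M ^ p) x * (Iic r').indicator 1 t := by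
    intro x t ht
    have hz := boundaryEmb_add_smul_mem x (le_of_lt ht)
    rw [halfSpaceProj_eq_self hz]
    by_cases hzK : boundaryEmb n x + t • normalVec n ∈ K
    · have hzr : ‖boundaryEmb n x + t • normalVec n‖ ≤ r := by simpa using hr hzK
      have hx : x ∈ B := by simpa [B] using (norm_le_norm_boundaryEmb_add x t).trans hzr
      have ht' : t ∈ Iic r' := ((le_abs_self t).trans
        ((abs_le_norm_boundaryEmb_add x t).trans hzr)).trans (le_max_left _ _)
      rw [indicator_of_mem hx, indicator_of_mem ht', Pi.one_apply, mul_one]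
      gcongr
      exact (le_abs_self _).trans (hM _ hzK)
    · rw [h0 _ hz hzK, ENNReal.ofReal_zero, ENNReal.zero_rpow_of_pos hp0]
      exact zero_le
  refine ne_top_of_le_ne_top ?_ (show energy volume s p _
    ≤ ∫⁻ x, B.indicator (fun _ => ENNReal.ofReal M ^ p) x
        * ENNReal.ofReal (r' ^ ((1 - s) * p) / ((1 - s) * p)) from ?_)
  · rw [lintegral_mul_const _ (measurable_const.indicator measurableSet_closedBall),
      lintegral_indicator measurableSet_closedBall, setLIntegral_const]
    refine ENNReal.mul_ne_top (ENNReal.mul_ne_top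
      (ENNReal.rpow_ne_top_of_nonneg hp0.le ENNReal.ofReal_ne_top) ?_) ENNReal.ofReal_ne_top
    exact measure_closedBall_lt_top.ne
  · refine lintegral_mono fun x => ?_
    have hb : B.indicator (fun _ => ENNReal.ofReal M ^ p) x ≠ ∞ := by
      by_cases hx : x ∈ B
      · rw [indicator_of_mem hx]
        exact ENNReal.rpow_ne_top_of_nonneg hp0.le ENNReal.ofReal_ne_top
      · rw [indicator_of_notMem hx]
        exact ENNReal.zero_ne_top
    rw [← lintegral_Ioc_rpow hq0 (le_max_right r 0), ← lintegral_const_mul' _ _ hb,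
      ← Ioi_inter_Iic, inter_comm, ← setLIntegral_indicator measurableSet_Iic]
    refine setLIntegral_mono' measurableSet_Ioi fun t ht => ?_
    refine (mul_le_mul_left (hpt x t ht) _).trans_eq ?_
    by_cases htr : t ∈ Iic r' <;> simp [htr, r']

theorem weightedIntegral_rpow_eq_energy {s p : ℝ} (hp : 0 < p)
    {φ : EuclideanSpace ℝ (Fin (n + 1)) → ℝ} (hφ : ContinuousOn φ (closedHalfSpace n))
    (h0 : ∀ z, 0 ≤ φ z) :
    weightedIntegral n s p (fun z => φ z ^ p) = energy volume s p
      (fun (x : EuclideanSpace ℝ (Fin n)) t =>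
        ENNReal.ofReal (φ (halfSpaceProj n (boundaryEmb n x + t • normalVec n)))) := by
  have hm : MeasurableSet (openHalfSpace n) :=
    (isOpen_lt continuous_const (by fun_prop)).measurableSet
  have hcont : Continuous fun z => φ (halfSpaceProj n z) :=
    hφ.comp_continuous (continuous_halfSpaceProj n) halfSpaceProj_mem
  have h1 : weightedIntegral n s p (fun z => φ z ^ p) = ∫⁻ z in openHalfSpace n,
      ENNReal.ofReal (φ (halfSpaceProj n z)) ^ p
        * ENNReal.ofReal (z (Fin.last n) ^ ((1 - s) * p - 1)) := by
    refine setLIntegral_congr_fun hm fun z hz => ?_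
    have hz : 0 < z (Fin.last n) := hz
    have hzc : z ∈ closedHalfSpace n := hz.le
    simp only
    rw [halfSpaceProj_eq_self hzc, ENNReal.ofReal_rpow_of_nonneg (h0 z) hp.le,
      ← ENNReal.ofReal_mul (Real.rpow_nonneg (h0 z) _), div_eq_mul_inv, ← Real.rpow_neg hz.le,
      neg_sub]
  have hmeas : Measurable fun z : EuclideanSpace ℝ (Fin (n + 1)) =>
      ENNReal.ofReal (φ (halfSpaceProj n z)) ^ p
        * ENNReal.ofReal (z (Fin.last n) ^ ((1 - s) * p - 1)) := by
    have hlast : Continuous fun z : EuclideanSpace ℝ (Fin (n + 1)) => z (Fin.last n) := by fun_prop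
    exact (hcont.measurable.ennreal_ofReal.pow_const p).mul
      (hlast.measurable.pow_const _).ennreal_ofReal
  rw [h1, lintegral_openHalfSpace hmeas, energy]
  simp

/-- Superadditivity of the lower integral is the direction needed, and it holds without
measurability. -/
theorem add_mul_weightedIntegral_le {s p : ℝ} (c : ℝ≥0)
    {φ ψ : EuclideanSpace ℝ (Fin (n + 1)) → ℝ} (hφ : ∀ z, 0 ≤ φ z) (hψ : ∀ z, 0 ≤ ψ z) :
    weightedIntegral n s p φ + c * weightedIntegral n s p ψ
      ≤ weightedIntegral n s p fun z => φ z + c * ψ z := by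
  unfold weightedIntegral
  rw [← lintegral_const_mul' _ _ ENNReal.coe_ne_top]
  refine (le_lintegral_add _ _).trans (setLIntegral_mono'
    (isOpen_lt continuous_const (by fun_prop)).measurableSet fun z hz => ?_)
  have hz : 0 < z (Fin.last n) := hz
  have hw := Real.rpow_nonneg hz.le (1 - (1 - s) * p)
  have h1 := hφ z
  have h2 := hψ z
  rw [← ENNReal.ofReal_coe_nnreal, ← ENNReal.ofReal_mul (NNReal.coe_nonneg c),
    ← ENNReal.ofReal_add (by positivity) (by positivity), add_div, mul_div_assoc]

theorem covDeriv_eq_zero {V : Type*} [NormedAddCommGroup V] [NormedSpace ℝ V] {Ω K : Set V}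
    {Γ : V → V →L[ℝ] (F →L[ℝ] F)} {U : V → F} (hK : IsClosed K)
    (hU : ∀ z ∈ Ω, z ∉ K → U z = 0) {z : V} (hz : z ∈ Ω) (hzK : z ∉ K) :
    covDeriv Ω Γ U z = 0 := by
  have h : U =ᶠ[𝓝[Ω] z] fun _ => 0 := by
    filter_upwards [self_mem_nhdsWithin, mem_nhdsWithin_of_mem_nhds (hK.isOpen_compl.mem_nhds hzK)]
      with y hy hyK using hU y hy hyK
  rw [covDeriv, h.fderivWithin_eq (hU z hz hzK), hU z hz hzK]
  simp

/-- Substitution y = x + h in the inner integral. -/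
theorem lintegral_gagliardo_eq {s p : ℝ} (hp : 0 < p) {u : EuclideanSpace ℝ (Fin n) → F}
    (A : EuclideanSpace ℝ (Fin n) → EuclideanSpace ℝ (Fin n) →L[ℝ] (F →L[ℝ] F)) :
    gagliardoSeminorm s p A u ^ p = ∫⁻ x, ∫⁻ h, kernel (s * p) h
      * ‖u x - segmentTransport A x (x + h) (u (x + h))‖ₑ ^ p := by
  rw [gagliardoSeminorm, ← ENNReal.rpow_mul, one_div_mul_cancel hp.ne', ENNReal.rpow_one]
  refine lintegral_congr fun x => ?_
  rw [← lintegral_add_left_eq_self _ x]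
  refine lintegral_congr fun h => ?_
  rw [kernel, finrank_euclideanSpace_fin, sub_add_cancel_left, norm_neg, div_eq_mul_inv,
    ← Real.rpow_neg (norm_nonneg _), mul_comm, ENNReal.ofReal_mul (by positivity),
    ← ENNReal.ofReal_rpow_of_nonneg (norm_nonneg _) hp.le, ofReal_norm]

end Trace

end GaugeTrace

/-! ### The trace theorem -/

open GaugeTrace
theorem mainTheorem4 (n : ℕ) (hn : 1 ≤ n) (s p : ℝ) (hs0 : 0 < s) (hs1 : s < 1) (hp : 1 ≤ p) :
    ∃ C : ℝ≥0, 0 < C ∧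
      ∀ (F : Type*) [NormedAddCommGroup F] [InnerProductSpace ℝ F] [FiniteDimensional ℝ F]
        (Γ : EuclideanSpace ℝ (Fin (n + 1)) →
          EuclideanSpace ℝ (Fin (n + 1)) →L[ℝ] (F →L[ℝ] F))
        (β : ℝ≥0) (U : EuclideanSpace ℝ (Fin (n + 1)) → F),
        IsC1ConnectionForm (closedHalfSpace n) Γ →
        curvatureNorm (closedHalfSpace n) Γ ≤ (β : ℝ≥0∞) →
        IsC1CompactlySupportedOn (closedHalfSpace n) U →
        gagliardoSeminorm s p (tangential Γ) (fun x => U (boundaryEmb n x)) ^ p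
            ≤ (C : ℝ≥0∞) * weightedIntegral n s p (fun z =>
                hsNorm (covDeriv (closedHalfSpace n) Γ U z) ^ p
                  + (β : ℝ) ^ (p / 2) * ‖U z‖ ^ p) ∧
        eLpNorm (fun x => U (boundaryEmb n x)) (ENNReal.ofReal p) volume ^ p
            ≤ (C : ℝ≥0∞)
              * weightedIntegral n s p (fun z =>
                  hsNorm (covDeriv (closedHalfSpace n) Γ U z) ^ p) ^ (1 - s)
              * weightedIntegral n s p (fun z => ‖U z‖ ^ p) ^ s := by
  have hp0 : 0 < p := by linarith
  -- Makes the boundary space nontrivial, as polar coordinates require.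
  have : Nonempty (Fin n) := ⟨⟨0, hn⟩⟩
  obtain ⟨C₁, hC₁⟩ := gagliardo_le (volume : Measure (EuclideanSpace ℝ (Fin n))) hs0 hs1 hp
  set C₂ : ℝ≥0∞ := 2 ^ (p - 1) * ENNReal.ofReal ((1 - s) * p + s ^ (1 - p)) with hC₂
  have h2 : (2 : ℝ≥0∞) ^ (p - 1) ≠ ∞ := ENNReal.rpow_ne_top_of_nonneg (by linarith) (by simp)
  have hC₂t : C₂ ≠ ∞ := ENNReal.mul_ne_top h2 ENNReal.ofReal_ne_top
  -- The constants are fixed before `F`, `Γ`, `β` and `U` appear; the summand 1 only secures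
  -- positivity.
  refine ⟨C₁ + C₂.toNNReal + 1, by positivity, fun F _ _ _ Γ β U hΓ hβ hU => ?_⟩
  obtain ⟨hU, K, hK, hKΩ, hU0⟩ := hU
  set Ω := closedHalfSpace n with hΩdef
  have hΩ : UniqueDiffOn ℝ Ω := uniqueDiffOn_closedHalfSpace n
  set e := normalVec n with he
  set φ : EuclideanSpace ℝ (Fin (n + 1)) → ℝ := fun z => hsNorm (covDeriv Ω Γ U z) with hφ
  have hφ0 : ∀ z, 0 ≤ φ z := fun z => Real.sqrt_nonneg _
  have hφc : ContinuousOn φ Ω :=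
    continuous_hsNorm.comp_continuousOn (continuousOn_covDeriv hΩ hΓ.1 hU)
  have hUc : ContinuousOn (fun z => ‖U z‖) Ω := hU.continuousOn.norm
  set f : EuclideanSpace ℝ (Fin n) → ℝ → ℝ≥0∞ := fun x t =>
    ENNReal.ofReal (φ (halfSpaceProj n (boundaryEmb n x + t • e))) with hf
  set g : EuclideanSpace ℝ (Fin n) → ℝ → ℝ≥0∞ := fun x t =>
    ENNReal.ofReal ‖U (halfSpaceProj n (boundaryEmb n x + t • e))‖ with hg
  have hmeas : ∀ φ : EuclideanSpace ℝ (Fin (n + 1)) → ℝ, ContinuousOn φ Ω →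
      Measurable fun z : EuclideanSpace ℝ (Fin n) × ℝ =>
        ENNReal.ofReal (φ (halfSpaceProj n (boundaryEmb n z.1 + z.2 • e))) := fun φ hφ => by
    have h1 : Continuous fun z => φ (halfSpaceProj n z) :=
      hφ.comp_continuous (continuous_halfSpaceProj n) halfSpaceProj_mem
    exact (ENNReal.continuous_ofReal.comp (h1.comp (by fun_prop))).measurable
  have hfm : Measurable (Function.uncurry f) := hmeas φ hφc
  have hgm : Measurable (Function.uncurry g) := hmeas _ hUc
  set u : EuclideanSpace ℝ (Fin n) → F := fun x => U (boundaryEmb n x) with hu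
  have huc : Continuous u :=
    hU.continuousOn.comp_continuous (boundaryEmb n).continuous boundaryEmb_mem
  have hfe : ∀ x, ∀ t, 0 ≤ t → f x t = ENNReal.ofReal (φ (boundaryEmb n x + t • e)) :=
    fun x t ht => by simp only [hf, halfSpaceProj_eq_self (boundaryEmb_add_smul_mem x ht), he]
  have hge : ∀ x, ∀ t, 0 ≤ t → g x t = ‖U (boundaryEmb n x + t • e)‖ₑ :=
    fun x t ht => by
      simp only [hg, halfSpaceProj_eq_self (boundaryEmb_add_smul_mem x ht), he, ofReal_norm]
  have hcov : ∀ x, ∀ t, 0 ≤ t → ∀ v,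
      ‖covDeriv Ω Γ U (boundaryEmb n x + t • e) v‖ₑ ≤ f x t * ENNReal.ofReal ‖v‖ := by
    intro x t ht v
    rw [hfe x t ht, ← ENNReal.ofReal_mul (hφ0 _), ← ofReal_norm]
    exact ENNReal.ofReal_le_ofReal (norm_apply_le_hsNorm _ v)
  have hcovn : ∀ x, ∀ t, 0 ≤ t → ‖covDeriv Ω Γ U (boundaryEmb n x + t • e) e‖ₑ ≤ f x t := by
    intro x t ht
    simpa [he] using hcov x t ht e
  have hb1 : ∀ x, ∀ t > 0, ‖u x‖ₑ ≤ g x t + ∫⁻ r in Ioc 0 t, f x r := by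
    intro x t ht
    have h1 := abs_norm_sub_norm_le_integral_covDeriv hΩ hΓ hU (le_of_lt ht)
      (z := boundaryEmb n x) (e := e) fun r hr => boundaryEmb_add_smul_mem x hr.1
    rw [zero_smul, add_zero] at h1
    have h3 : ‖u x‖ ≤ ‖U (boundaryEmb n x + t • e)‖
        + ∫ r in (0 : ℝ)..t, ‖covDeriv Ω Γ U (boundaryEmb n x + r • e) e‖ := by
      linarith [(abs_le.1 h1).1]
    rw [← ofReal_norm]
    refine (ENNReal.ofReal_le_ofReal h3).trans (ENNReal.ofReal_add_le.trans ?_)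
    rw [hge x t (le_of_lt ht), ofReal_norm]
    gcongr
    refine ofReal_intervalIntegral_le (le_of_lt ht) fun r hr => ?_
    rw [enorm_norm]
    exact hcovn x r hr.1.le
  have hρ : ∀ x h, ‖u x - segmentTransport (tangential Γ) x (x + h) (u (x + h))‖ₑ
      ≤ ‖u x‖ₑ + ‖u (x + h)‖ₑ := by
    intro x h
    obtain ⟨R, hR, hRe⟩ := exists_segmentTransport_eq hΓ.1.continuousOn x h
    have h1 := hR.norm_apply (fun l _ => by
      rw [← map_smul, ← map_add]
      exact hΓ.isSkew (boundaryEmb_mem _) _) (left_mem_Icc.2 zero_le_one) (u (x + h))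
    refine (enorm_sub_le).trans_eq ?_
    rw [hRe, ← ofReal_norm (R 0 _), h1, ofReal_norm]
  have hρ1 : ∀ x h, ‖u x - segmentTransport (tangential Γ) x (x + h) (u (x + h))‖ₑ
      ≤ ENNReal.ofReal ‖h‖ * (∫⁻ l in Ioc (0 : ℝ) 1, f (x + l • h) ‖h‖)
        + ∫⁻ t in Ioc 0 ‖h‖, (f x t + f (x + h) t + ENNReal.ofReal (β * ‖h‖) * g (x + h) t) := by
    intro x h
    obtain ⟨R, hR, hRe⟩ := exists_segmentTransport_eq hΓ.1.continuousOn x h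
    -- The rectangle is as high as it is long, and the unit normal `e` gives the curvature bound κ =
    -- β‖h‖.
    have h1 := norm_sub_transport_le hΩ hΓ hU (x := boundaryEmb n x) (h := boundaryEmb n h)
      (e := e) (τ := ‖h‖) (κ := β * ‖h‖) (norm_nonneg h) (fun l _ t ht => by
        rw [← map_smul, ← map_add]
        exact boundaryEmb_add_smul_mem _ ht.1) (fun z hz => by
        simpa [he, norm_boundaryEmb] using norm_curvature_le hβ hz (boundaryEmb n h) e) hR
    simp only [← map_smul, ← map_add] at h1
    rw [← ofReal_norm, hRe]
    refine (ENNReal.ofReal_le_ofReal h1).trans (ENNReal.ofReal_add_le.trans (add_le_add ?_ ?_))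
    · rw [← lintegral_const_mul' _ _ ENNReal.ofReal_ne_top]
      refine ofReal_intervalIntegral_le zero_le_one fun l _ => ?_
      rw [enorm_norm, mul_comm, ← norm_boundaryEmb h]
      simpa only [norm_boundaryEmb] using
        hcov (x + l • h) ‖h‖ (norm_nonneg h) (boundaryEmb n h)
    · refine ofReal_intervalIntegral_le (norm_nonneg h) fun t ht => ?_
      refine (enorm_add_le _ _).trans (add_le_add ((enorm_add_le _ _).trans (add_le_add ?_ ?_)) ?_)
      · rw [enorm_norm]
        exact hcovn x t ht.1.le
      · rw [enorm_norm]
        exact hcovn (x + h) t ht.1.le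
      · rw [enorm_mul, enorm_norm, hge _ t ht.1.le,
          Real.enorm_of_nonneg (mul_nonneg (NNReal.coe_nonneg β) (norm_nonneg h))]
  have hwf : weightedIntegral n s p (fun z => φ z ^ p) = energy volume s p f :=
    weightedIntegral_rpow_eq_energy hp0 hφc hφ0
  have hwg : weightedIntegral n s p (fun z => ‖U z‖ ^ p) = energy volume s p g :=
    weightedIntegral_rpow_eq_energy hp0 hUc fun z => norm_nonneg _
  constructor
  · rw [lintegral_gagliardo_eq hp0]
    refine (hC₁ f g (fun x => ‖u x‖ₑ)
      (fun x h => ‖u x - segmentTransport (tangential Γ) x (x + h) (u (x + h))‖ₑ) β hfm hgm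
      huc.enorm.measurable hb1 hρ hρ1).trans ?_
    have h3 := add_mul_weightedIntegral_le (n := n) (s := s) (p := p) (β ^ (p / 2))
      (φ := fun z => φ z ^ p) (ψ := fun z => ‖U z‖ ^ p)
      (fun z => Real.rpow_nonneg (hφ0 z) _) fun z => by positivity
    rw [hwf, hwg, NNReal.coe_rpow, ENNReal.coe_rpow_of_nonneg _ (by positivity)] at h3
    refine mul_le_mul' ?_ h3
    rw [add_assoc]
    exact_mod_cast le_self_add
  -- The parameters are those of the trace estimate at scale `T`; `A` is the energy of |U| and `B`
  -- that of |D_Γ U|.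
  · have h4 := le_of_forall_scale (q := (1 - s) * p) (c := s ^ (1 - p)) hs0 hs1 hp0 rfl
      (by positivity) (X := ∫⁻ x, ‖u x‖ₑ ^ p)
      (energy_lt_top hs1 hp hUc hK hKΩ fun z hz hzK => by simp [hU0 z hz hzK])
      (energy_lt_top hs1 hp hφc hK hKΩ fun z hz hzK => by
        simp [hφ, covDeriv_eq_zero hK.isClosed hU0 hz hzK, hsNorm]) h2
      fun T hT => trace_le volume hs0 hs1 hp hfm hgm hb1 hT
    rw [eLpNorm_eq_lintegral_rpow_enorm_toReal (by simpa using hp0) (by simp),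
      ENNReal.toReal_ofReal hp0.le, ← ENNReal.rpow_mul, one_div_mul_cancel hp0.ne',
      ENNReal.rpow_one, hwf, hwg]
    refine h4.trans ?_
    gcongr
    rw [← hC₂, ← ENNReal.coe_toNNReal hC₂t]
    exact_mod_cast le_add_self.trans le_self_add
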